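/- Let $z=e^{2\pi i/3}$ and write $^\ast$ for complex conjugation. For $a<b$ let $S(a,b)=\{re^{i\theta}: r>0,\ a<\theta<b\}$ and put $\Omega_1=S(\tfrac{2\pi}{3},\tfrac{4\pi}{3})$, $\Omega_2=S(-\tfrac{2\pi}{3},-\tfrac{\pi}{3})$, $\Omega_3=S(-\tfrac{\pi}{3},\tfrac{\pi}{3})$, $\Omega_4=S(\tfrac{\pi}{3},\tfrac{2\pi}{3})$. Let $\mathcal L=\{zs:s\in\mathbb R\}$, and let $\mathcal P^{+}$, $\mathcal P^{-}$ be the open half planes to the left and to the right of $\mathcal L$, i.e. $\mathcal P^{\pm}=\{k:\pm\operatorname{Im}(z^{-1}k)>0\}$. Let $N\ge 1$, let $k_1,\dots,k_N$ be distinct complex numbers with $\arg k_j\in[7\pi/6,4\pi/3)$, and let $E(k_1),\dots,E(k_N)$ be nonzero complex numbers. Put $$F(k)=\prod_{j=1}^N(k+k_j^\ast),\quad G(k)=\prod_{j=1}^N(k-k_j),\quad T_{\rm l}(k)=\frac{F(k)}{G(k)},\quad T_{\rm r}(k)=\frac{G(k)}{F(k)},\quad \gamma(k_j)=-\frac{F(k_j)E(k_j)}{G(zk_j)},$$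 $$\chi(k_j)=\exp\big((z-1)k_jx+9(z^2-1)k_j^5t\big),\qquad m_l(k_j)=k_j^l+(zk_j)^l\gamma(k_j)\chi(k_j),$$ for $x,t\in\mathbb R$. Let $\mathbf M$ be the $N\times N$ matrix whose $j$th row is $[m_{N-1}(k_j),\dots,m_0(k_j)]$, let $\mathbf B$ be the column with entries $m_N(k_j)$, let $V(k)=[k^{N-1},\dots,k,1]$, let $D=\{(x,t)\in\mathbb R^2:\det\mathbf M(x,t)\ne0\}$, and on $D$ let $\mathbf A=[A_{N-1},\dots,A_0]^{T}=-\mathbf M^{-1}\mathbf B$; put $A_{-1}=0$. On $D$ define $$f=e^{kx}\frac{k^N+V(k)\mathbf A}{F(k)}\ (k\in\overline{\Omega_1}),\qquad m,\ g,\ n=e^{kx}\frac{k^N+V(k)\mathbf A}{G(k)}\ (k\in\overline{\Omega_2},\ \overline{\Omega_3},\ \overline{\Omega_4}\text{ respectively}),$$ $$Q=-3A_{N-1}',\qquad P=3\big(A_{N-1}A_{N-1}'-A_{N-1}''-A_{N-2}'\big),$$ where $'$ is $\partial/\partial x$. Then the following hold. 1. $D$ is open, and for every $t$ the set $\{x:(x,t)\in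 D\}$ is dense in $\mathbb R$. For each $j$, $\chi(k_j)$ is real for all $x,t$ if and only if $k_j=iz\eta_j$ for some $\eta_j>0$. 2. On $D$, the system $k_j^N+V(k_j)\mathbf a=-\gamma(k_j)\chi(k_j)\big[(zk_j)^N+V(zk_j)\mathbf a\big]$, $1\le j\le N$, is equivalent to $\mathbf M\mathbf a=-\mathbf B$, and $\mathbf a=\mathbf A$ is its only solution. By Cramer's rule, the $c$th entry of $\mathbf A$ is $-\det\mathbf M_c/\det\mathbf M$, where $\mathbf M_c$ is $\mathbf M$ with its $c$th column replaced by $\mathbf B$. The entries of $\mathbf A$ are $C^\infty$ on $D$. 3. Fix $(x,t)\in D$. Consider the following Riemann–Hilbert problem. Find $\Phi_+$, analytic in $\mathcal P^+$ and continuous on $\overline{\mathcal P^+}$ except for at most simple poles at $k_1,\dots,k_N$, and $\Phi_-$, analytic in $\mathcal P^-$ and continuous on $\overline{\mathcal P^-}$, such that $\Phi_+=\Phi_-$ on $\mathcal L$, $\Phi_\pm=e^{kx}[1+O(1/k)]$ as $k\to\infty$ in $\overline{\mathcal P^\pm}$, and $$\lim_{k\to k_j}\frac{\Phi_+(k)}{T_{\rm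 l}(k)}=E(k_j)e^{9(z^2-1)k_j^5t}\,\Phi_-(zk_j),\qquad 1\le j\le N .$$ Its unique solution (away from the poles $k_j$) is $\Phi_\pm=e^{kx}\big(k^N+V(k)\mathbf A\big)/G(k)$. That is, $\Phi_+=T_{\rm l}f$ on $\overline{\Omega_1}\setminus\{k_1,\dots,k_N\}$, $\Phi_+=m$ on $\overline{\Omega_2}$, $\Phi_-=g$ on $\overline{\Omega_3}$ and $\Phi_-=n$ on $\overline{\Omega_4}$. The denominators of $f,m,g,n$ do not vanish on the respective closed sectors, and $f(k_j,x)=E(k_j)e^{9(z^2-1)k_j^5t}g(zk_j,x)$ for all $j$. 4. On $D$, with $\Sigma_N=\sum_jk_j^\ast$, $\Pi_N=\sum_{i\le j}k_i^\ast k_j^\ast$, $u_1=A_{N-1}-\Sigma_N$ and $u_2=A_{N-2}-\Sigma_NA_{N-1}+\Pi_N$, $$e^{-kx}f=1+\frac{u_1}{k}+\frac{u_2}{k^2}+O\Big(\frac1{k^3}\Big),\qquad k\to\infty\text{ in }\overline{\Omega_1},$$ and $Q=-3u_1'$, $P=3(u_1u_1'-u_1''-u_2')$. 5. On $D$, each of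 $f,m,g,n$ satisfies $\psi'''+Q\psi'+P\psi=k^3\psi$ for every $k$ in the closed sector where it is defined. For every $t$: as $x\to-\infty$, $e^{-kx}\partial_x^{l}g\to k^l$ $(l=0,1,2)$ for $k\in\overline{\Omega_3}$, and $e^{-kx}f\to T_{\rm l}(k)^{-1}$ for $k\in\overline{\Omega_1}$ (where $T_{\rm l}(k_j)^{-1}=0$). If moreover every $k_j$ has the form $iz\eta_j$ with $\eta_j>0$, then, as $x\to+\infty$, $e^{-kx}\partial_x^{l}f\to k^l$ $(l=0,1,2)$ for $k\in\overline{\Omega_1}$, and $e^{-kx}g\to T_{\rm r}(k)^{-1}$ for $k\in\overline{\Omega_3}$. 6. $Q$ and $P$ are $C^\infty$ on $D$ and there satisfy the coupled system $$Q_t+Q_{xxxxx}+5Q_xQ_{xx}+5QQ_{xxx}+5Q^2Q_x+15Q_{xx}P+15Q_xP_x-30PP_x=0,$$ $$P_t+P_{xxxxx}+5QP_{xxx}+15Q_xP_{xx}+20Q_{xx}P_x+5Q^2P_x+10Q_{xxx}P-15PP_{xx}+10QQ_xP-15P_x^2=0.$$ 7. If $N=1$ and $k_1=iz\eta_1$ with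 $\eta_1>0$, put $w=\gamma(k_1)e^{\sqrt3\,\eta_1(x-9\eta_1^4t)}$. Then $D=\{(x,t):1+w\ne0\}$, and on $D$ $$Q=\frac{9\eta_1^2\,w}{(1+w)^2},\qquad P=\frac{9iz\,\eta_1^3\,w\,(z+w)}{(1+w)^3}.$$ If $\gamma(k_1)>0$, then $D=\mathbb R^2$, $Q$ is real valued, and $P$ is nowhere real. -/

import Mathlib

open scoped ContDiff Topology ComplexConjugate

noncomputable section

namespace NSoliton

/-! ### Geometry of the spectral plane -/

/-- The cube root of unity `z = e^{2πi/3}`. -/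
def z : ℂ := -1 / 2 + Complex.I * ((Real.sqrt 3 : ℝ) / 2)

/-- The nonzero complex numbers having an argument in the set `S` of angles. -/
def sector (S : Set ℝ) : Set ℂ :=
  {κ | ∃ r : ℝ, 0 < r ∧ ∃ θ ∈ S, κ = r * Complex.exp (θ * Complex.I)}

/-- `2π/3 < arg κ < 4π/3`. -/
def Omega1 : Set ℂ := sector (Set.Ioo (2 * Real.pi / 3) (4 * Real.pi / 3))
/-- `-2π/3 < arg κ < -π/3`. -/
def Omega2 : Set ℂ := sector (Set.Ioo (-(2 * Real.pi / 3)) (-(Real.pi / 3)))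
/-- `-π/3 < arg κ < π/3`. -/
def Omega3 : Set ℂ := sector (Set.Ioo (-(Real.pi / 3)) (Real.pi / 3))
/-- `π/3 < arg κ < 2π/3`. -/
def Omega4 : Set ℂ := sector (Set.Ioo (Real.pi / 3) (2 * Real.pi / 3))

/-- The sector `7π/6 ≤ arg κ < 4π/3` in which the poles are located. -/
def poleSector : Set ℂ := sector (Set.Ico (7 * Real.pi / 6) (4 * Real.pi / 3))

/-- The full line `{z s : s ∈ ℝ}`. -/
def lineL : Set ℂ := {κ | ∃ s : ℝ, κ = z * s}

/-- The open half plane to the left of the line `{z s : s ∈ ℝ}`. -/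
def plusRegion : Set ℂ := {κ | 0 < (z⁻¹ * κ).im}

/-- The open half plane to the right of the line `{z s : s ∈ ℝ}`. -/
def minusRegion : Set ℂ := {κ | (z⁻¹ * κ).im < 0}

/-! ### The linear equation and the nonlinear system -/

/-- `ψ''' + Q ψ' + P ψ = κ³ ψ` at the point `x`. -/
def SolvesLinear (Q P : ℝ → ℂ) (κ : ℂ) (ψ : ℝ → ℂ) (x : ℝ) : Prop :=
  iteratedDeriv 3 ψ x + Q x * deriv ψ x + P x * ψ x = κ ^ 3 * ψ x

/-- The coupled fifth-order system for `Q` and `P` at the point `(x, t)`. -/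
def SolvesSystem (Q P : ℝ → ℝ → ℂ) (x t : ℝ) : Prop :=
  let q : ℕ → ℂ := fun n => iteratedDeriv n (fun y => Q y t) x
  let p : ℕ → ℂ := fun n => iteratedDeriv n (fun y => P y t) x
  deriv (fun s => Q x s) t + q 5 + 5 * q 1 * q 2 + 5 * q 0 * q 3 + 5 * q 0 ^ 2 * q 1
      + 15 * q 2 * p 0 + 15 * q 1 * p 1 - 30 * p 0 * p 1 = 0 ∧
  deriv (fun s => P x s) t + p 5 + 5 * q 0 * p 3 + 15 * q 1 * p 2 + 20 * q 2 * p 1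
      + 5 * q 0 ^ 2 * p 1 + 10 * q 3 * p 0 - 15 * p 0 * p 2
      + 10 * q 0 * q 1 * p 0 - 15 * p 1 ^ 2 = 0

/-- Smooth (classical) solutions of the coupled system on a set of points `(x, t)`. -/
def IsClassicalSolutionOn (Q P : ℝ → ℝ → ℂ) (D : Set (ℝ × ℝ)) : Prop :=
  ContDiffOn ℝ ∞ (fun p : ℝ × ℝ => Q p.1 p.2) D ∧
  ContDiffOn ℝ ∞ (fun p : ℝ × ℝ => P p.1 p.2) D ∧
  ∀ x t : ℝ, (x, t) ∈ D → SolvesSystem Q P x t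

/-! ### The input data -/

variable {N : ℕ}

/-- `F(κ) = ∏ (κ + k_j^*)`. -/
def F (k : Fin N → ℂ) (κ : ℂ) : ℂ := ∏ j, (κ + conj (k j))

/-- `G(κ) = ∏ (κ - k_j)`. -/
def G (k : Fin N → ℂ) (κ : ℂ) : ℂ := ∏ j, (κ - k j)

/-- The left transmission coefficient. -/
def Tl (k : Fin N → ℂ) (κ : ℂ) : ℂ := F k κ / G k κ

/-- The right transmission coefficient. -/
def Tr (k : Fin N → ℂ) (κ : ℂ) : ℂ := G k κ / F k κ

/-- The time-evolved dependency constant at the pole `k j`. -/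
def depConst (k E : Fin N → ℂ) (j : Fin N) (t : ℝ) : ℂ :=
  E j * Complex.exp (9 * (z ^ 2 - 1) * k j ^ 5 * t)

/-- The Riemann--Hilbert problem at a fixed point `(x, t)`, for the plus function `Φp` on the
closed left half plane and the minus function `Φm` on the closed right half plane. -/
structure IsRHSolution (k E : Fin N → ℂ) (x t : ℝ) (Φp Φm : ℂ → ℂ) : Prop where
  plus_holo : DifferentiableOn ℂ Φp (plusRegion \ Set.range k)
  plus_cont : ContinuousOn Φp (closure plusRegion \ Set.range k)
  /-- `Φp` has at most simple poles at the poles of the left transmission coefficient. -/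
  plus_pole : ∀ j, MeromorphicAt Φp (k j) ∧ (-1 : WithTop ℤ) ≤ meromorphicOrderAt Φp (k j)
  minus_holo : DifferentiableOn ℂ Φm minusRegion
  minus_cont : ContinuousOn Φm (closure minusRegion)
  jump : ∀ κ ∈ lineL, Φp κ = Φm κ
  plus_asymp : (fun κ : ℂ => Complex.exp (-(κ * x)) * Φp κ - 1)
    =O[Bornology.cobounded ℂ ⊓ Filter.principal (closure plusRegion)] fun κ => κ⁻¹
  minus_asymp : (fun κ : ℂ => Complex.exp (-(κ * x)) * Φm κ - 1)
    =O[Bornology.cobounded ℂ ⊓ Filter.principal (closure minusRegion)] fun κ => κ⁻¹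
  /-- The bound-state relation `f(k_j) = D(k_j) g(z k_j)`, where `f = Φp / Tl` is extended to
  `k_j` by continuity, where `g = Φm`, and where `D(k_j)` is the dependency constant. -/
  bound_state : ∀ j, Filter.Tendsto (fun κ => Φp κ / Tl k κ) (𝓝[≠] (k j))
    (𝓝 (depConst k E j t * Φm (z * k j)))

/-! ### The explicit construction -/

/-- The modified initial dependency constants. -/
def gam (k E : Fin N → ℂ) (j : Fin N) : ℂ := -(F k (k j) * E j) / G k (z * k j)

def chi (k : Fin N → ℂ) (j : Fin N) (x t : ℝ) : ℂ :=
  Complex.exp ((z - 1) * k j * x + 9 * (z ^ 2 - 1) * k j ^ 5 * t)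

def mEntry (k E : Fin N → ℂ) (l : ℕ) (j : Fin N) (x t : ℝ) : ℂ :=
  k j ^ l + (z * k j) ^ l * gam k E j * chi k j x t

/-- The matrix `M`: the entry in row `j` and column `c = 0, …, N - 1` is `m_{N-1-c}(k_j)`. -/
def matM (k E : Fin N → ℂ) (x t : ℝ) : Matrix (Fin N) (Fin N) ℂ :=
  Matrix.of fun j c => mEntry k E (c.rev : ℕ) j x t

def vecB (k E : Fin N → ℂ) (x t : ℝ) : Fin N → ℂ := fun j => mEntry k E N j x t

/-- The row vector `V(κ) = [κ^{N-1}, …, κ, 1]`. -/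
def vecV (N : ℕ) (κ : ℂ) : Fin N → ℂ := fun c => κ ^ (c.rev : ℕ)

/-- The vector `A = [A_{N-1}, …, A_0]`: the entry at position `c` is `A_{N-1-c}`. -/
def vecA (k E : Fin N → ℂ) (x t : ℝ) : Fin N → ℂ :=
  -(Matrix.mulVec (matM k E x t)⁻¹ (vecB k E x t))

/-- `coeffA k E c` is `A_{N-1-c}`, with the convention that `A_l = 0` for negative `l`. -/
def coeffA (k E : Fin N → ℂ) (c : ℕ) (x t : ℝ) : ℂ :=
  if h : c < N then vecA k E x t ⟨c, h⟩ else 0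

/-- The points `(x, t)` at which the linear system is nonsingular. -/
def regularSet (k E : Fin N → ℂ) : Set (ℝ × ℝ) := {p | (matM k E p.1 p.2).det ≠ 0}

/-- `e^{κx} (κ^N + V(κ) A(x))`. -/
def numer (k E : Fin N → ℂ) (κ : ℂ) (x t : ℝ) : ℂ :=
  Complex.exp (κ * x) * (κ ^ N + dotProduct (vecV N κ) (vecA k E x t))

def Phi (k E : Fin N → ℂ) (κ : ℂ) (x t : ℝ) : ℂ := numer k E κ x t / G k κ

def solf (k E : Fin N → ℂ) (κ : ℂ) (x t : ℝ) : ℂ := numer k E κ x t / F k κ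
def solm (k E : Fin N → ℂ) (κ : ℂ) (x t : ℝ) : ℂ := numer k E κ x t / G k κ
def solg (k E : Fin N → ℂ) (κ : ℂ) (x t : ℝ) : ℂ := numer k E κ x t / G k κ
def soln (k E : Fin N → ℂ) (κ : ℂ) (x t : ℝ) : ℂ := numer k E κ x t / G k κ

/-- `Q = -3 A_{N-1}'`. -/
def potQ (k E : Fin N → ℂ) (x t : ℝ) : ℂ := -3 * deriv (fun y => coeffA k E 0 y t) x

/-- `P = 3 (A_{N-1} A_{N-1}' - A_{N-1}'' - A_{N-2}')`. -/
def potP (k E : Fin N → ℂ) (x t : ℝ) : ℂ :=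
  3 * (coeffA k E 0 x t * deriv (fun y => coeffA k E 0 y t) x
    - iteratedDeriv 2 (fun y => coeffA k E 0 y t) x - deriv (fun y => coeffA k E 1 y t) x)

/-- `Σ_N`. -/
def sigmaN (k : Fin N → ℂ) : ℂ := ∑ j, conj (k j)

/-- `Π_N`. -/
def piN (k : Fin N → ℂ) : ℂ := ∑ i, conj (k i) * ∑ j ∈ Finset.Ici i, conj (k j)

def u1 (k E : Fin N → ℂ) (x t : ℝ) : ℂ := coeffA k E 0 x t - sigmaN k

def u2 (k E : Fin N → ℂ) (x t : ℝ) : ℂ :=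
  coeffA k E 1 x t - sigmaN k * coeffA k E 0 x t + piN k

/-- `ψ(x) = e^{κx}[1 + o(1)]`, `ψ'(x) = κ e^{κx}[1 + o(1)]`, `ψ''(x) = κ² e^{κx}[1 + o(1)]`
along the filter `l` (`x → ∞` for the left, `x → -∞` for the right Jost solution). -/
def HasJostAsymptotics (l : Filter ℝ) (κ : ℂ) (ψ : ℝ → ℂ) : Prop :=
  ∀ n : ℕ, n ≤ 2 →
    Filter.Tendsto (fun x : ℝ => Complex.exp (-(κ * x)) * iteratedDeriv n ψ x) l (𝓝 (κ ^ n))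

end NSoliton

end

noncomputable section

namespace NSoliton

/-! ### Differential algebra of dressing polynomials -/

section Algebra

open Polynomial

variable {R : Type*} [CommRing R] [Algebra ℂ R]

/-! The argument is a dressing method carried out in a polynomial ring. Let `R` be the ring of
smooth functions on the regular set and `p = X^N + A_{N-1} X^{N-1} + … + A_0` in `R[X]`. The linear
system says that `q = p` satisfies `q(k_j) + γ(k_j) χ(k_j) q(z k_j) = 0` for all `j`. Since `χ(k_j)`
is the quotient of the values of `e^{κx + 9κ⁵t}` at `z k_j` and at `k_j`, these relations survive
the operators `∂_x + X` and `∂_t + 9X⁵`. They survive multiplication by `X³` because `(z k_j)³ =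
k_j³`. As `det M ≠ 0`, a polynomial of degree below `N` that satisfies them is zero.

Any combination of these operators applied to `p` therefore vanishes once its coefficients in degree
`≥ N` do. With `D = ∂_x + X`, the potentials `Q` and `P` are exactly what makes `(D³ + QD + P -
X³)p` drop below degree `N` (`IsDressed.lax_x`), and a fifth-order operator in `D` reproduces `∂_t +
9X⁵` on `p` (`IsDressed.lax_t`). Cross-differentiation leaves a first-order relation `αDp + βp = 0`,
whose two leading coefficients give `α = β = 0`: the coupled system (`IsDressed.system`). Evaluating
at `X = κ` and multiplying by `e^{κx}` gives the linear equation for `f, m, g, n`.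

For uniqueness in the Riemann–Hilbert problem, the two halves are glued along the line and become
holomorphic across it by a Morera argument. After multiplication by `e^{-κx} G` the result is entire
and differs from `G` by `O(κ^{N-1})`, so it is a monic polynomial of degree `N`. The bound-state
relations are the rows of the linear system for its coefficients (`numerator_of_isRHSolution`).

As `x → -∞` the exponentials `χ(k_j)` vanish and the system becomes a Vandermonde system with nodes
`k_j`; as `x → +∞`, after rescaling the rows, one with nodes `z k_j`. Its solution is the product
over the nodes (`Tame.monic_prod`). This gives the Jost asymptotics, and, with real analyticity of
the determinant, density of the regular set on time slices. -/

/-- Coefficientwise application of a derivation to a polynomial. -/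
def coeffD (d : Derivation ℂ R R) : R[X] →+ R[X] where
  toFun p := p.sum fun i a => monomial i (d a)
  map_zero' := by simp
  map_add' p q := Polynomial.sum_add_index p q _ (by simp) (by simp)

@[simp]
theorem coeff_coeffD (d : Derivation ℂ R R) (p : R[X]) (i : ℕ) :
    (coeffD d p).coeff i = d (p.coeff i) := by
  simp only [coeffD, AddMonoidHom.coe_mk, ZeroHom.coe_mk, Polynomial.sum, finsetSum_coeff,
    coeff_monomial, Finset.sum_ite_eq']
  split_ifs with h
  · rfl
  · simp [notMem_support_iff.1 h]

theorem coeffD_X_mul (d : Derivation ℂ R R) (p : R[X]) : coeffD d (X * p) = X * coeffD d p := by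
  ext i
  cases i <;> simp

theorem coeffD_X_pow_mul (d : Derivation ℂ R R) (m : ℕ) (p : R[X]) :
    coeffD d (X ^ m * p) = X ^ m * coeffD d p := by
  induction m with
  | zero => simp
  | succ m ih => rw [pow_succ', mul_assoc, coeffD_X_mul, ih, mul_assoc]

theorem coeffD_C_mul (d : Derivation ℂ R R) (a : R) (p : R[X]) :
    coeffD d (C a * p) = C (d a) * p + C a * coeffD d p := by
  ext i
  simp [Derivation.leibniz]
  ring

theorem eval_coeffD (d : Derivation ℂ R R) (c : ℂ) (p : R[X]) :
    (coeffD d p).eval (algebraMap ℂ R c) = d (p.eval (algebraMap ℂ R c)) := by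
  induction p using Polynomial.induction_on' with
  | add p q hp hq => simp [hp, hq]
  | monomial n a =>
    have : coeffD d (monomial n a) = monomial n (d a) := by
      ext i
      simp only [coeff_coeffD, coeff_monomial]
      split_ifs <;> simp
    rw [this]
    simp only [eval_monomial, Derivation.leibniz, ← map_pow, Derivation.map_algebraMap]
    simp [mul_comm]

/-- The operator `p ↦ e^{-φ} d (e^{φ} p)` on polynomials, where `d φ = c X ^ m`. -/
def twistD (d : Derivation ℂ R R) (c : ℂ) (m : ℕ) : R[X] →+ R[X] :=
  coeffD d + AddMonoidHom.mulLeft (C (algebraMap ℂ R c) * X ^ m)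

theorem twistD_apply (d : Derivation ℂ R R) (c : ℂ) (m : ℕ) (p : R[X]) :
    twistD d c m p = coeffD d p + C (algebraMap ℂ R c) * X ^ m * p := rfl

theorem twistD_C_mul (d : Derivation ℂ R R) (c : ℂ) (m : ℕ) (a : R) (p : R[X]) :
    twistD d c m (C a * p) = C (d a) * p + C a * twistD d c m p := by
  simp only [twistD_apply, coeffD_C_mul]
  ring

theorem twistD_X_pow_mul (d : Derivation ℂ R R) (c : ℂ) (m n : ℕ) (p : R[X]) :
    twistD d c m (X ^ n * p) = X ^ n * twistD d c m p := by
  simp only [twistD_apply, coeffD_X_pow_mul]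
  ring

theorem twistD_comm (d d' : Derivation ℂ R R) (h : ∀ a, d (d' a) = d' (d a)) (c c' : ℂ) (m m' : ℕ)
    (p : R[X]) : twistD d c m (twistD d' c' m' p) = twistD d' c' m' (twistD d c m p) := by
  simp only [twistD_apply, map_add, mul_assoc, coeffD_C_mul, coeffD_X_pow_mul,
    Derivation.map_algebraMap]
  have : coeffD d (coeffD d' p) = coeffD d' (coeffD d p) := by
    ext i
    simp [h]
  rw [this]
  simp
  ring

theorem eval_twistD (d : Derivation ℂ R R) (c κ : ℂ) (m : ℕ) (p : R[X]) :
    (twistD d c m p).eval (algebraMap ℂ R κ) =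
      d (p.eval (algebraMap ℂ R κ)) + algebraMap ℂ R (c * κ ^ m) * p.eval (algebraMap ℂ R κ) := by
  simp [twistD_apply, eval_coeffD]

/-- The polynomials `q` with `q(u_j) + χ_j q(v_j) = 0` for all `j`. -/
def dressing {ι : Type*} (u v : ι → ℂ) (χ : ι → R) : Submodule R R[X] where
  carrier := {q | ∀ j, q.eval (algebraMap ℂ R (u j)) + χ j * q.eval (algebraMap ℂ R (v j)) = 0}
  add_mem' {p q} hp hq j := by
    simp only [eval_add]
    linear_combination hp j + hq j
  zero_mem' j := by simp
  smul_mem' a q hq j := by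
    simp only [eval_smul, smul_eq_mul]
    linear_combination a * hq j

variable {ι : Type*} {u v : ι → ℂ} {χ : ι → R}

theorem mem_dressing {q : R[X]} : q ∈ dressing u v χ ↔
    ∀ j, q.eval (algebraMap ℂ R (u j)) + χ j * q.eval (algebraMap ℂ R (v j)) = 0 := Iff.rfl

theorem C_mul_mem_dressing {q : R[X]} (a : R) (hq : q ∈ dressing u v χ) :
    C a * q ∈ dressing u v χ := by
  rw [← smul_eq_C_mul]
  exact Submodule.smul_mem _ _ hq

/-- If `dφ = c X^m`, the hypothesis on `χ_j` says that it evolves like a constant times `e^{φ(v_j) -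
φ(u_j)}`. The defining relation is then one with constant coefficients between the values of `e^φ q`
at `u_j` and `v_j`, and `d` preserves such a relation. -/
theorem twistD_mem_dressing {d : Derivation ℂ R R} {c : ℂ} {m : ℕ}
    (hχ : ∀ j, d (χ j) = algebraMap ℂ R (c * (v j ^ m - u j ^ m)) * χ j)
    {q : R[X]} (hq : q ∈ dressing u v χ) : twistD d c m q ∈ dressing u v χ := by
  intro j
  have h := congrArg d (hq j)
  simp only [map_add, Derivation.leibniz, smul_eq_mul, map_zero, hχ j, map_mul, map_sub] at h
  simp only [eval_twistD, map_mul]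
  linear_combination h + algebraMap ℂ R c * algebraMap ℂ R (u j ^ m) * hq j

end Algebra

/-! ### The Lax pair and its compatibility condition -/

section Lax

open Polynomial

variable {R : Type*} [CommRing R] [Algebra ℂ R]

/-- A monic polynomial of degree `N` is determined by its dressing relations, which evolve with
the exponentials `e^{κ x + 9 κ⁵ t}`. -/
structure IsDressed (dx dt : Derivation ℂ R R) (N : ℕ) {ι : Type*} (u v : ι → ℂ) (χ : ι → R)
    (p : R[X]) : Prop where
  comm : ∀ a, dx (dt a) = dt (dx a)
  dx_chi : ∀ j, dx (χ j) = algebraMap ℂ R (1 * (v j ^ 1 - u j ^ 1)) * χ j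
  dt_chi : ∀ j, dt (χ j) = algebraMap ℂ R (9 * (v j ^ 5 - u j ^ 5)) * χ j
  cube : ∀ j, u j ^ 3 = v j ^ 3
  mem : p ∈ dressing u v χ
  lead : p.coeff N = 1
  high : ∀ i, N < i → p.coeff i = 0
  eq_zero : ∀ q ∈ dressing u v χ, (∀ i, N ≤ i → q.coeff i = 0) → q = 0

/-- The coefficient of `X ^ (N - i)` in `p`, for `i ≤ 5`. -/
def lowCoeff (N : ℕ) (p : R[X]) (i : ℕ) : R := (X ^ 5 * p).coeff (N + 5 - i)

/-- The coefficient `Q` of the third-order operator annihilating the dressed exponential. -/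
def dressedQ (dx : Derivation ℂ R R) (N : ℕ) (p : R[X]) : R := -3 * dx (lowCoeff N p 1)

/-- The coefficient `P` of the third-order operator annihilating the dressed exponential. -/
def dressedP (dx : Derivation ℂ R R) (N : ℕ) (p : R[X]) : R :=
  3 * (lowCoeff N p 1 * dx (lowCoeff N p 1) - dx (dx (lowCoeff N p 1)) - dx (lowCoeff N p 2))

variable {dx dt : Derivation ℂ R R} {N : ℕ} {ι : Type*} {u v : ι → ℂ} {χ : ι → R} {p : R[X]}

theorem twistD_one_coeff_succ (d : Derivation ℂ R R) (q : R[X]) (m : ℕ) :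
    (twistD d 1 1 q).coeff (m + 1) = d (q.coeff (m + 1)) + q.coeff m := by
  simp [twistD_apply]

theorem derivation_ofNat (d : Derivation ℂ R R) (n : ℕ) [n.AtLeastTwo] :
    d (ofNat(n) : R) = 0 := by
  rw [← Nat.cast_ofNat (R := R)]
  exact d.map_natCast n

/-- Both sides satisfy the dressing relations, the right one because `u_j³ = v_j³`. By `eq_zero` it
suffices to compare coefficients in degree at least `N`. -/
theorem IsDressed.lax_x (h : IsDressed dx dt N u v χ p) :
    twistD dx 1 1 (twistD dx 1 1 (twistD dx 1 1 p)) + C (dressedQ dx N p) * twistD dx 1 1 p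
      + C (dressedP dx N p) * p = X ^ 3 * p := by
  have hD : ∀ q ∈ dressing u v χ, twistD dx 1 1 q ∈ dressing u v χ := fun q hq =>
    twistD_mem_dressing h.dx_chi hq
  have hX : X ^ 3 * p ∈ dressing u v χ := by
    intro j
    simp only [eval_mul, eval_pow, eval_X, ← map_pow, h.cube j]
    linear_combination algebraMap ℂ R (v j ^ 3) * h.mem j
  rw [← sub_eq_zero]
  refine h.eq_zero _ ?_ fun i hi => ?_
  · exact Submodule.sub_mem _ (Submodule.add_mem _ (Submodule.add_mem _ (hD _ (hD _ (hD _ h.mem)))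
      (C_mul_mem_dressing _ (hD _ h.mem))) (C_mul_mem_dressing _ h.mem)) hX
  -- Everything is multiplied by `X^5`, which commutes with the twisted derivations. The indices `N
  -- + 5 - i` then involve no truncated subtraction even when `N < 5`, and coefficients below degree
  -- zero are read as zeros.
  · rw [← coeff_X_pow_mul _ 5]
    simp only [mul_sub, mul_add, mul_left_comm (X ^ 5) (C _), ← twistD_X_pow_mul,
      mul_left_comm (X ^ 5) (X ^ 3) _]
    have hr1 : (X ^ 5 * p).coeff (N + 4) = lowCoeff N p 1 := rfl
    have hr2 : (X ^ 5 * p).coeff (N + 3) = lowCoeff N p 2 := rfl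
    have h0 : (X ^ 5 * p).coeff (N + 5) = 1 := by rw [coeff_X_pow_mul, h.lead]
    have hz : ∀ m, N + 6 ≤ m → (X ^ 5 * p).coeff m = 0 := fun m hm => by
      obtain ⟨m, rfl⟩ : ∃ m', m = m' + 5 := ⟨m - 5, by omega⟩
      rw [coeff_X_pow_mul, h.high _ (by omega)]
    generalize X ^ 5 * p = r at *
    have hX3 : ∀ m, (X ^ 3 * r).coeff (m + 3) = r.coeff m := fun m => coeff_X_pow_mul r 3 m
    have hz1 : r.coeff (N + 6) = 0 := hz _ le_rfl
    have hz2 : r.coeff (N + 7) = 0 := hz _ (by omega)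
    have hz3 : r.coeff (N + 8) = 0 := hz _ (by omega)
    have key : ∀ m, N + 5 ≤ m + 3 →
        (twistD dx 1 1 (twistD dx 1 1 (twistD dx 1 1 r)) + C (dressedQ dx N p) * twistD dx 1 1 r
          + C (dressedP dx N p) * r - X ^ 3 * r).coeff (m + 3) = 0 := by
      intro m hm
      simp only [coeff_add, coeff_sub, coeff_C_mul, twistD_one_coeff_succ, hX3, map_add]
      -- These are the degrees `N`, `N + 1`, `N + 2`, `N + 3` and higher before the shift by `X^5`.
      -- Degree `N + 1` dictates `Q`, degree `N` dictates `P`, and the others cancel identically.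
      rcases (show m = N + 2 ∨ m = N + 3 ∨ m = N + 4 ∨ m = N + 5 ∨ N + 6 ≤ m by omega) with
        rfl | rfl | rfl | rfl | hm
      · simp only [h0, hr1, hr2, map_zero, Derivation.map_one_eq_zero, dressedQ, dressedP]
        ring
      · simp only [h0, hz1, hr1, map_zero, Derivation.map_one_eq_zero, dressedQ]
        ring
      · simp only [h0, hz1, hz2, map_zero, Derivation.map_one_eq_zero]
        ring
      · simp only [h0, hz1, hz2, hz3, map_zero]
        ring
      · simp only [hz m hm, hz (m + 1) (by omega), hz (m + 2) (by omega), hz (m + 3) (by omega),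
          map_zero]
        ring
    obtain ⟨m, hm⟩ : ∃ m, i + 5 = m + 3 := ⟨i + 2, rfl⟩
    rw [hm]
    exact key m (by omega)

/-- These are the coefficients of `X^(N-1)` and `X^(N-2)` in `lax_x`. They express the
`x`-derivatives of the third and fourth low coefficients through earlier ones, which is what removes
these coefficients from the fifth-order computation. -/
theorem IsDressed.lowCoeff_relations (h : IsDressed dx dt N u v χ p) :
    3 * dx (lowCoeff N p 3) + 3 * dx (dx (lowCoeff N p 2)) + dx (dx (dx (lowCoeff N p 1)))
      + dressedQ dx N p * (lowCoeff N p 2 + dx (lowCoeff N p 1))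
      + dressedP dx N p * lowCoeff N p 1 = 0 ∧
    3 * dx (lowCoeff N p 4) + 3 * dx (dx (lowCoeff N p 3)) + dx (dx (dx (lowCoeff N p 2)))
      + dressedQ dx N p * (lowCoeff N p 3 + dx (lowCoeff N p 2))
      + dressedP dx N p * lowCoeff N p 2 = 0 := by
  have e := congrArg (X ^ 5 * ·) h.lax_x
  simp only [mul_add, mul_left_comm (X ^ 5) (C _), ← twistD_X_pow_mul,
    mul_left_comm (X ^ 5) (X ^ 3) _] at e
  have hr1 : (X ^ 5 * p).coeff (N + 4) = lowCoeff N p 1 := rfl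
  have hr2 : (X ^ 5 * p).coeff (N + 3) = lowCoeff N p 2 := rfl
  have hr3 : (X ^ 5 * p).coeff (N + 2) = lowCoeff N p 3 := rfl
  have hr4 : (X ^ 5 * p).coeff (N + 1) = lowCoeff N p 4 := rfl
  generalize X ^ 5 * p = r at *
  have hX3 : ∀ m, (X ^ 3 * r).coeff (m + 3) = r.coeff m := fun m => coeff_X_pow_mul r 3 m
  constructor
  · have e1 := congrArg (fun q => q.coeff (N + 1 + 3)) e
    simp only [coeff_add, coeff_C_mul, twistD_one_coeff_succ, hX3, map_add, hr1, hr2, hr3,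
      add_assoc, Nat.reduceAdd] at e1
    linear_combination e1
  · have e1 := congrArg (fun q => q.coeff (N + 3)) e
    simp only [coeff_add, coeff_C_mul, twistD_one_coeff_succ, hX3, map_add, hr2, hr3, hr4] at e1
    linear_combination e1

/-- Same principle as for `lax_x`: the difference of the two sides satisfies the dressing relations.
The operator coefficients are forced, from the third-order one down to the zeroth-order one, by
requiring degrees `N + 3` to `N` to cancel. -/
theorem IsDressed.lax_t (h : IsDressed dx dt N u v χ p) :
    twistD dt 9 5 p = 9 * twistD dx 1 1 (twistD dx 1 1 (twistD dx 1 1 (twistD dx 1 1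
        (twistD dx 1 1 p))))
      + C (15 * dressedQ dx N p) * twistD dx 1 1 (twistD dx 1 1 (twistD dx 1 1 p))
      + C (15 * (dressedP dx N p + dx (dressedQ dx N p))) * twistD dx 1 1 (twistD dx 1 1 p)
      + C (5 * dressedQ dx N p ^ 2 + 15 * dx (dressedP dx N p) + 10 * dx (dx (dressedQ dx N p)))
        * twistD dx 1 1 p
      + C (10 * (dressedQ dx N p * dressedP dx N p + dx (dx (dressedP dx N p)))) * p := by
  have hD : ∀ q ∈ dressing u v χ, twistD dx 1 1 q ∈ dressing u v χ := fun q hq =>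
    twistD_mem_dressing h.dx_chi hq
  obtain ⟨e3, e4⟩ := h.lowCoeff_relations
  have e3' := congrArg dx e3
  rw [show (9 : R[X]) = C 9 from rfl, ← sub_eq_zero]
  refine h.eq_zero _ ?_ fun i hi => ?_
  · exact Submodule.sub_mem _ (twistD_mem_dressing h.dt_chi h.mem)
      (Submodule.add_mem _ (Submodule.add_mem _ (Submodule.add_mem _ (Submodule.add_mem _
      (C_mul_mem_dressing _ (hD _ (hD _ (hD _ (hD _ (hD _ h.mem))))))
      (C_mul_mem_dressing _ (hD _ (hD _ (hD _ h.mem)))))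
      (C_mul_mem_dressing _ (hD _ (hD _ h.mem))))
      (C_mul_mem_dressing _ (hD _ h.mem))) (C_mul_mem_dressing _ h.mem))
  · rw [← coeff_X_pow_mul _ 5]
    simp only [mul_sub, mul_add, mul_left_comm (X ^ 5) (C _), ← twistD_X_pow_mul]
    have hr1 : (X ^ 5 * p).coeff (N + 4) = lowCoeff N p 1 := rfl
    have hr2 : (X ^ 5 * p).coeff (N + 3) = lowCoeff N p 2 := rfl
    have hr3 : (X ^ 5 * p).coeff (N + 2) = lowCoeff N p 3 := rfl
    have hr4 : (X ^ 5 * p).coeff (N + 1) = lowCoeff N p 4 := rfl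
    have h0 : (X ^ 5 * p).coeff (N + 5) = 1 := by rw [coeff_X_pow_mul, h.lead]
    have hz : ∀ m, N + 6 ≤ m → (X ^ 5 * p).coeff m = 0 := fun m hm => by
      obtain ⟨m, rfl⟩ : ∃ m', m = m' + 5 := ⟨m - 5, by omega⟩
      rw [coeff_X_pow_mul, h.high _ (by omega)]
    generalize X ^ 5 * p = r at *
    have hX5 : ∀ m, (twistD dt 9 5 r).coeff (m + 5) = dt (r.coeff (m + 5)) + 9 * r.coeff m := by
      intro m
      simp only [twistD_apply, coeff_add, coeff_coeffD, mul_assoc, coeff_C_mul, coeff_X_pow_mul]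
      simp only [map_ofNat]
    have hz1 : r.coeff (N + 6) = 0 := hz _ le_rfl
    have hz2 : r.coeff (N + 7) = 0 := hz _ (by omega)
    have hz3 : r.coeff (N + 8) = 0 := hz _ (by omega)
    have hz4 : r.coeff (N + 9) = 0 := hz _ (by omega)
    have hz5 : r.coeff (N + 10) = 0 := hz _ (by omega)
    obtain ⟨m, rfl⟩ := Nat.exists_eq_add_of_le' hi
    rw [coeff_sub, hX5]
    simp only [coeff_add, coeff_C_mul, twistD_one_coeff_succ, dx.map_add]
    rcases (show m = 0 ∨ m = 1 ∨ m = 2 ∨ m = 3 ∨ m = 4 ∨ m = 5 ∨ 6 ≤ m by omega) with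
      rfl | rfl | rfl | rfl | rfl | rfl | hm
    · simp only [zero_add, h0, hr1, hr2, hr3, hr4, map_zero, Derivation.map_one_eq_zero]
      simp only [dressedQ, dressedP, map_add, map_zero, map_sub, Derivation.leibniz, smul_eq_mul,
        derivation_ofNat, neg_mul, map_neg] at e3 e4 e3' ⊢
      -- In degree `N` the fifth-order term contributes `45` times the derivative of the fourth low
      -- coefficient, and `e4` contains `3` times it, hence the factor `15`. The derivative of `e3`
      -- then removes the third coefficient.
      linear_combination (-15) * e4 - 15 * e3'
    · simp only [add_comm 1 N, h0, hr1, hr2, hr3, hz1, map_zero, Derivation.map_one_eq_zero]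
      simp only [dressedQ, dressedP, map_add, map_zero, map_sub, Derivation.leibniz, smul_eq_mul,
        derivation_ofNat, neg_mul, map_neg] at e3 ⊢
      linear_combination (-15) * e3
    · simp only [add_comm 2 N, h0, hr1, hr2, hz1, hz2, map_zero, Derivation.map_one_eq_zero]
      simp only [dressedQ, dressedP, map_neg, Derivation.leibniz, smul_eq_mul, derivation_ofNat,
        neg_mul]
      ring
    · simp only [add_comm 3 N, h0, hr1, hz1, hz2, hz3, map_zero, Derivation.map_one_eq_zero]
      simp only [dressedQ]
      ring
    · simp only [add_comm 4 N, h0, hz1, hz2, hz3, hz4, hr1, map_zero, Derivation.map_one_eq_zero]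
      ring
    · simp only [add_comm 5 N, h0, hz1, hz2, hz3, hz4, hz5, map_zero]
      ring
    · simp only [hz (m + N) (by omega), hz (m + N + 1) (by omega), hz (m + N + 2) (by omega),
        hz (m + N + 3) (by omega), hz (m + N + 4) (by omega), hz (m + N + 5) (by omega), map_zero]
      ring

/-- Apply the twisted `t`-derivation to `lax_x` and eliminate it with `lax_t`. This computes the
commutator form of the Lax equation, in which all terms of order at least two in the twisted
`x`-derivation cancel and the two fifth-order equations remain as coefficients. -/
theorem IsDressed.compatibility (h : IsDressed dx dt N u v χ p) {Q P : R}
    (hQ : Q = dressedQ dx N p) (hP : P = dressedP dx N p) :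
    C (dt Q + dx (dx (dx (dx (dx Q)))) + 5 * dx Q * dx (dx Q) + 5 * Q * dx (dx (dx Q))
        + 5 * Q ^ 2 * dx Q + 15 * dx (dx Q) * P + 15 * dx Q * dx P - 30 * P * dx P)
      * twistD dx 1 1 p
    + C (dt P + dx (dx (dx (dx (dx P)))) + 5 * Q * dx (dx (dx P)) + 15 * dx Q * dx (dx P)
        + 20 * dx (dx Q) * dx P + 5 * Q ^ 2 * dx P + 10 * dx (dx (dx Q)) * P
        - 15 * P * dx (dx P) + 10 * Q * dx Q * P - 15 * dx P ^ 2) * p = 0 := by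
  have hx := h.lax_x
  have ht := h.lax_t
  rw [← hQ, ← hP] at hx ht
  have hcomm : ∀ q, twistD dt 9 5 (twistD dx 1 1 q) = twistD dx 1 1 (twistD dt 9 5 q) :=
    fun q => twistD_comm dt dx (fun a => (h.comm a).symm) _ _ _ _ q
  have e := congrArg (twistD dt 9 5) hx
  simp only [map_add, twistD_C_mul, twistD_X_pow_mul, hcomm] at e
  have hX : ∀ q, X ^ 3 * twistD dx 1 1 q = twistD dx 1 1 (X ^ 3 * q) := fun q =>
    (twistD_X_pow_mul _ _ _ _ _).symm
  -- The second expression for the same quantity: `X^3` is moved inside past every twisted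
  -- derivation until it meets `p`, where `lax_x` replaces it by the third-order operator.
  have e2 : X ^ 3 * twistD dt 9 5 p = _ := congrArg (X ^ 3 * ·) ht
  rw [show (9 : R[X]) = C 9 from rfl] at ht e2
  simp only [mul_add, mul_left_comm (X ^ 3) (C _), hX, ← hx] at e2
  rw [e2, ht] at e
  clear e2 ht hx hcomm hX hQ hP h
  simp only [map_add (twistD dx 1 1), twistD_C_mul, dx.leibniz, dx.map_add, smul_eq_mul, pow_two,
    derivation_ofNat, map_zero, mul_zero, zero_mul, zero_add, add_zero] at e
  simp only [map_add C, map_mul C, map_ofNat C, map_sub C, map_pow C] at e ⊢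
  linear_combination e

theorem IsDressed.system (h : IsDressed dx dt N u v χ p) {Q P : R}
    (hQ : Q = dressedQ dx N p) (hP : P = dressedP dx N p) :
    dt Q + dx (dx (dx (dx (dx Q)))) + 5 * dx Q * dx (dx Q) + 5 * Q * dx (dx (dx Q))
        + 5 * Q ^ 2 * dx Q + 15 * dx (dx Q) * P + 15 * dx Q * dx P - 30 * P * dx P = 0 ∧
    dt P + dx (dx (dx (dx (dx P)))) + 5 * Q * dx (dx (dx P)) + 15 * dx Q * dx (dx P)
        + 20 * dx (dx Q) * dx P + 5 * Q ^ 2 * dx P + 10 * dx (dx (dx Q)) * P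
        - 15 * P * dx (dx P) + 10 * Q * dx Q * P - 15 * dx P ^ 2 = 0 := by
  have e := h.compatibility hQ hP
  generalize dt Q + dx (dx (dx (dx (dx Q)))) + 5 * dx Q * dx (dx Q) + 5 * Q * dx (dx (dx Q))
        + 5 * Q ^ 2 * dx Q + 15 * dx (dx Q) * P + 15 * dx Q * dx P - 30 * P * dx P = r at *
  -- In degree `N + 1` only the twisted derivative of `p` contributes, with coefficient `1`. Once
  -- its multiplier is known to vanish, monicity of `p` settles the other.
  have e1 := congrArg (fun q => q.coeff (N + 1)) e
  simp only [coeff_add, coeff_C_mul, twistD_one_coeff_succ, h.lead, h.high (N + 1) (by omega),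
    map_zero, coeff_zero] at e1
  obtain rfl : r = 0 := by linear_combination e1
  have e0 := congrArg (fun q => q.coeff N) e
  simp only [coeff_add, coeff_C_mul, h.lead, map_zero, zero_mul, coeff_zero] at e0
  exact ⟨rfl, by linear_combination e0⟩

end Lax

/-! ### The differential ring of smooth functions on an open set -/

section SmoothRing

variable {E : Type*} {D : Set E}

/-- Extension by zero of a function on `D`. -/
def extZero (g : D → ℂ) : E → ℂ := Function.extend Subtype.val g 0

theorem extZero_apply (g : D → ℂ) {p : E} (hp : p ∈ D) : extZero g p = g ⟨p, hp⟩ :=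
  Subtype.val_injective.extend_apply g 0 ⟨p, hp⟩

theorem extZero_eventuallyEq [TopologicalSpace E] (hD : IsOpen D) {f : E → ℂ} {g : D → ℂ} (h : ∀ p : D, f p = g p)
    {p : E} (hp : p ∈ D) : extZero g =ᶠ[𝓝 p] f := by
  filter_upwards [hD.mem_nhds hp] with q hq
  rw [extZero_apply _ hq, ← h ⟨q, hq⟩]

variable [NormedAddCommGroup E] [NormedSpace ℝ E]

/-- The algebra of smooth complex-valued functions on `D`. -/
def smoothRing (D : Set E) : Subalgebra ℂ (D → ℂ) where
  -- Elements are functions on the subtype, so equality in the ring is equality on `D` alone. The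
  -- extension by zero only serves to speak of smoothness; its values off `D` play no role when `D`
  -- is open.
  carrier := {g | ContDiffOn ℝ ∞ (extZero g) D}
  mul_mem' {f g} hf hg := (hf.mul hg).congr fun p hp => by simp [extZero_apply _ hp]
  add_mem' {f g} hf hg := (hf.add hg).congr fun p hp => by simp [extZero_apply _ hp]
  algebraMap_mem' c := (contDiffOn_const (c := c)).congr fun p hp => by simp [extZero_apply _ hp]

/-- The element of `smoothRing D` given by a function that is smooth on `D`. -/
def smoothRing.ofFun (f : E → ℂ) (hf : ContDiffOn ℝ ∞ f D) : smoothRing D :=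
  ⟨fun p => f p, hf.congr fun _ hp => extZero_apply _ hp⟩

theorem smoothRing.ofFun_apply (f : E → ℂ) (hf : ContDiffOn ℝ ∞ f D) (p : D) :
    (smoothRing.ofFun f hf).1 p = f p := rfl

theorem smoothRing_contDiffAt (hD : IsOpen D) (g : smoothRing D) {p : E} (hp : p ∈ D) :
    ContDiffAt ℝ ∞ (extZero g.1) p :=
  ContDiffOn.contDiffAt g.2 (hD.mem_nhds hp)

theorem smoothRing_differentiableAt (hD : IsOpen D) (g : smoothRing D) {p : E} (hp : p ∈ D) :
    DifferentiableAt ℝ (extZero g.1) p :=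
  (smoothRing_contDiffAt hD g hp).differentiableAt (by simp)

/-- The derivative in the direction `v`, as a derivation of `smoothRing D`. -/
def dirD (hD : IsOpen D) (v : E) : Derivation ℂ (smoothRing D) (smoothRing D) :=
  Derivation.mk'
    { toFun g := smoothRing.ofFun (fun p => fderiv ℝ (extZero g.1) p v)
        (ContDiffOn.clm_apply (ContDiffOn.fderiv_of_isOpen (m := ∞) (n := ∞) g.2 hD (by simp)) contDiffOn_const)
      map_add' f g := by
        refine Subtype.ext (funext fun (p : D) => ?_)
        have : extZero (f + g : smoothRing D).1 =ᶠ[𝓝 p.1] extZero f.1 + extZero g.1 :=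
          extZero_eventuallyEq hD (fun q => by simp [extZero_apply _ q.2]) p.2
        change fderiv ℝ (extZero (f + g : smoothRing D).1) p.1 v =
          fderiv ℝ (extZero f.1) p.1 v + fderiv ℝ (extZero g.1) p.1 v
        rw [this.fderiv_eq, fderiv_add (smoothRing_differentiableAt hD f p.2) (smoothRing_differentiableAt hD g p.2)]
        rfl
      map_smul' c g := by
        refine Subtype.ext (funext fun (p : D) => ?_)
        have : extZero (c • g : smoothRing D).1 =ᶠ[𝓝 p.1] c • extZero g.1 :=
          extZero_eventuallyEq hD (fun q => by simp [extZero_apply _ q.2]) p.2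
        change fderiv ℝ _ _ _ = c * fderiv ℝ _ _ _
        rw [this.fderiv_eq, fderiv_const_smul (smoothRing_differentiableAt hD g p.2)]
        rfl }
    fun f g => by
      refine Subtype.ext (funext fun (p : D) => ?_)
      have : extZero (f * g : smoothRing D).1 =ᶠ[𝓝 p.1] extZero f.1 * extZero g.1 :=
        extZero_eventuallyEq hD (fun q => by simp [extZero_apply _ q.2]) p.2
      change fderiv ℝ _ _ _ = f.1 p * fderiv ℝ _ _ _ + g.1 p * fderiv ℝ _ _ _
      rw [this.fderiv_eq, fderiv_mul (smoothRing_differentiableAt hD f p.2) (smoothRing_differentiableAt hD g p.2)]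
      simp [extZero_apply _ p.2]

theorem dirD_apply (hD : IsOpen D) (v : E) (g : smoothRing D) (p : D) :
    (dirD hD v g).1 p = fderiv ℝ (extZero g.1) p v := rfl

theorem dirD_comm (hD : IsOpen D) (v w : E) (g : smoothRing D) :
    dirD hD v (dirD hD w g) = dirD hD w (dirD hD v g) := by
  have key : ∀ (a b : E) (p : D), (dirD hD a (dirD hD b g)).1 p =
      fderiv ℝ (fderiv ℝ (extZero g.1)) p a b := by
    intro a b p
    have h1 : extZero (dirD hD b g).1 =ᶠ[𝓝 p.1] fun q => fderiv ℝ (extZero g.1) q b :=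
      extZero_eventuallyEq hD (fun q => (dirD_apply hD b g q).symm) p.2
    have h2 : DifferentiableAt ℝ (fderiv ℝ (extZero g.1)) p.1 :=
      ((smoothRing_contDiffAt hD g p.2).fderiv_right (m := 1) (by norm_cast)).differentiableAt (by simp)
    rw [dirD_apply, h1.fderiv_eq, fderiv_clm_apply h2 (differentiableAt_const b)]
    simp
  apply Subtype.ext
  funext p
  rw [key, key]
  refine ((smoothRing_contDiffAt hD g p.2).isSymmSndFDerivAt ?_) v w
  simp only [minSmoothness_of_isRCLikeNormedField]
  exact WithTop.coe_le_coe.2 le_top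

end SmoothRing

/-! ### Partial derivatives of functions as derivations of the ring -/

section Slices

variable {D : Set (ℝ × ℝ)} (hD : IsOpen D)

theorem hasDerivAt_fst {f : ℝ × ℝ → ℂ} {g : smoothRing D} (h : ∀ p : D, f p = g.1 p) {x t : ℝ}
    (hp : (x, t) ∈ D) : HasDerivAt (fun y => f (y, t)) ((dirD hD (1, 0) g).1 ⟨(x, t), hp⟩) x := by
  have h1 : HasFDerivAt f (fderiv ℝ (extZero g.1) (x, t)) (x, t) :=
    (smoothRing_differentiableAt hD g hp).hasFDerivAt.congr_of_eventuallyEq (extZero_eventuallyEq hD h hp).symm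
  exact h1.comp_hasDerivAt x ((hasDerivAt_id x).prodMk (hasDerivAt_const x t))

theorem hasDerivAt_snd {f : ℝ × ℝ → ℂ} {g : smoothRing D} (h : ∀ p : D, f p = g.1 p) {x t : ℝ}
    (hp : (x, t) ∈ D) : HasDerivAt (fun s => f (x, s)) ((dirD hD (0, 1) g).1 ⟨(x, t), hp⟩) t := by
  have h1 : HasFDerivAt f (fderiv ℝ (extZero g.1) (x, t)) (x, t) :=
    (smoothRing_differentiableAt hD g hp).hasFDerivAt.congr_of_eventuallyEq (extZero_eventuallyEq hD h hp).symm
  exact h1.comp_hasDerivAt t ((hasDerivAt_const t x).prodMk (hasDerivAt_id t))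

theorem iteratedDeriv_fst {f : ℝ × ℝ → ℂ} {g : smoothRing D} (h : ∀ p : D, f p = g.1 p) (n : ℕ)
    {x t : ℝ} (hp : (x, t) ∈ D) :
    iteratedDeriv n (fun y => f (y, t)) x = ((dirD hD (1, 0))^[n] g).1 ⟨(x, t), hp⟩ := by
  induction n generalizing x with
  | zero => simpa using h ⟨_, hp⟩
  | succ n ih =>
    -- The induction hypothesis is used on a neighbourhood of `x`, since it is about to be
    -- differentiated.
    have hev : ∀ᶠ y in 𝓝 x, (y, t) ∈ D :=
      (Continuous.prodMk_left t).continuousAt.preimage_mem_nhds (hD.mem_nhds hp)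
    rw [iteratedDeriv_succ, Function.iterate_succ_apply']
    refine HasDerivAt.deriv ?_
    have h1 := hasDerivAt_fst hD (f := extZero ((dirD hD (1, 0))^[n] g).1)
      (fun p => extZero_apply _ p.2) hp
    refine h1.congr_of_eventuallyEq ?_
    filter_upwards [hev] with y hy
    rw [ih hy, extZero_apply _ hy]

theorem dirD_fst_eq {f : ℝ × ℝ → ℂ} {g r : smoothRing D} (h : ∀ p : D, f p = g.1 p)
    (h' : ∀ x t : ℝ, ∀ hp : (x, t) ∈ D, HasDerivAt (fun y => f (y, t)) (r.1 ⟨(x, t), hp⟩) x) :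
    dirD hD (1, 0) g = r := by
  apply Subtype.ext
  funext p
  exact (hasDerivAt_fst hD h p.2).unique (h' _ _ p.2)

theorem dirD_snd_eq {f : ℝ × ℝ → ℂ} {g r : smoothRing D} (h : ∀ p : D, f p = g.1 p)
    (h' : ∀ x t : ℝ, ∀ hp : (x, t) ∈ D, HasDerivAt (fun s => f (x, s)) (r.1 ⟨(x, t), hp⟩) t) :
    dirD hD (0, 1) g = r := by
  apply Subtype.ext
  funext p
  exact (hasDerivAt_snd hD h p.2).unique (h' _ _ p.2)

end Slices

/-! ### Geometry of the spectral plane -/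

section Geometry

theorem sqrt_three_sq : (Real.sqrt 3) ^ 2 = 3 := Real.sq_sqrt (by norm_num)

theorem sqrt_three_pos : 0 < Real.sqrt 3 := Real.sqrt_pos.2 (by norm_num)

theorem z_re : z.re = -1 / 2 := by simp [z]

theorem z_im : z.im = Real.sqrt 3 / 2 := by simp [z]

theorem z_sq : z ^ 2 = -1 - z := by
  have h := sqrt_three_sq
  apply Complex.ext <;> simp only [pow_two, Complex.mul_re, Complex.mul_im, z_re, z_im,
    Complex.sub_re, Complex.sub_im, Complex.neg_re, Complex.neg_im, Complex.one_re, Complex.one_im]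
  · linarith
  · ring

theorem z_cube : z ^ 3 = 1 := by
  linear_combination (z - 1) * z_sq

theorem z_ne_zero : z ≠ 0 := fun h => by simpa [h] using z_cube

theorem z_inv : z⁻¹ = -1 - z := by
  rw [← z_sq]
  exact inv_eq_of_mul_eq_one_right (by rw [← z_cube]; ring)

theorem z_inv_mul_im (κ : ℂ) : (z⁻¹ * κ).im = (-(Real.sqrt 3 * κ.re) - κ.im) / 2 := by
  rw [z_inv]
  simp only [Complex.mul_im, Complex.sub_re, Complex.sub_im, Complex.neg_re, Complex.neg_im,
    Complex.one_re, Complex.one_im, z_re, z_im]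
  ring

theorem mem_plusRegion {κ : ℂ} : κ ∈ plusRegion ↔ κ.im < -(Real.sqrt 3 * κ.re) := by
  rw [plusRegion, Set.mem_ofPred_eq, z_inv_mul_im]
  constructor <;> intro <;> linarith

theorem isOpenMap_z_inv_mul : IsOpenMap fun κ : ℂ => z⁻¹ * κ :=
  (Homeomorph.mulLeft₀ _ (inv_ne_zero z_ne_zero)).isOpenMap

theorem closure_plusRegion : closure plusRegion = {κ | 0 ≤ (z⁻¹ * κ).im} := by
  change closure ((fun κ : ℂ => z⁻¹ * κ) ⁻¹' {κ | 0 < κ.im}) = _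
  rw [← isOpenMap_z_inv_mul.preimage_closure_eq_closure_preimage (by fun_prop),
    Complex.closure_setOfPred_lt_im]
  rfl

theorem closure_minusRegion : closure minusRegion = {κ | (z⁻¹ * κ).im ≤ 0} := by
  change closure ((fun κ : ℂ => z⁻¹ * κ) ⁻¹' {κ | κ.im < 0}) = _
  rw [← isOpenMap_z_inv_mul.preimage_closure_eq_closure_preimage (by fun_prop),
    Complex.closure_setOfPred_im_lt]
  rfl

theorem mem_lineL {κ : ℂ} : κ ∈ lineL ↔ (z⁻¹ * κ).im = 0 := by
  constructor
  · rintro ⟨s, rfl⟩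
    simp [z_ne_zero]
  · intro h
    refine ⟨(z⁻¹ * κ).re, ?_⟩
    have : ((z⁻¹ * κ).re : ℂ) = z⁻¹ * κ := Complex.ext rfl (by simp [h])
    rw [this, mul_inv_cancel_left₀ z_ne_zero]

theorem mem_closure_plusRegion {κ : ℂ} :
    κ ∈ closure plusRegion ↔ κ.im ≤ -(Real.sqrt 3 * κ.re) := by
  rw [closure_plusRegion, Set.mem_ofPred_eq, z_inv_mul_im]
  constructor <;> intro <;> linarith

theorem mem_closure_minusRegion {κ : ℂ} :
    κ ∈ closure minusRegion ↔ -(Real.sqrt 3 * κ.re) ≤ κ.im := by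
  rw [closure_minusRegion, Set.mem_ofPred_eq, z_inv_mul_im]
  constructor <;> intro <;> linarith

theorem polar_re (r θ : ℝ) : (r * Complex.exp (θ * Complex.I) : ℂ).re = r * Real.cos θ := by
  rw [Complex.re_ofReal_mul, Complex.exp_ofReal_mul_I_re]

theorem polar_im (r θ : ℝ) : (r * Complex.exp (θ * Complex.I) : ℂ).im = r * Real.sin θ := by
  rw [Complex.im_ofReal_mul, Complex.exp_ofReal_mul_I_im]

theorem sin_sub_third (θ : ℝ) :
    2 * Real.sin (θ - Real.pi / 3) = Real.sin θ - Real.sqrt 3 * Real.cos θ := by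
  rw [Real.sin_sub, Real.cos_pi_div_three, Real.sin_pi_div_three]
  ring

theorem sin_add_third (θ : ℝ) :
    2 * Real.sin (θ + Real.pi / 3) = Real.sin θ + Real.sqrt 3 * Real.cos θ := by
  rw [Real.sin_add, Real.cos_pi_div_three, Real.sin_pi_div_three]
  ring

theorem sin_sub_two_thirds (θ : ℝ) :
    2 * Real.sin (θ - 2 * Real.pi / 3) = -Real.sin θ - Real.sqrt 3 * Real.cos θ := by
  rw [show θ - 2 * Real.pi / 3 = θ + Real.pi / 3 - Real.pi by ring, Real.sin_sub_pi]
  linarith [sin_add_third θ]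

theorem sin_add_two_thirds (θ : ℝ) :
    2 * Real.sin (θ + 2 * Real.pi / 3) = -Real.sin θ + Real.sqrt 3 * Real.cos θ := by
  rw [show θ + 2 * Real.pi / 3 = θ - Real.pi / 3 + Real.pi by ring, Real.sin_add_pi]
  linarith [sin_sub_third θ]

theorem sin_sub_seven_sixths (θ : ℝ) :
    2 * Real.sin (θ - 7 * Real.pi / 6) = Real.cos θ - Real.sqrt 3 * Real.sin θ := by
  rw [show θ - 7 * Real.pi / 6 = θ - Real.pi / 6 - Real.pi by ring, Real.sin_sub_pi, Real.sin_sub,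
    Real.cos_pi_div_six, Real.sin_pi_div_six]
  ring

/-- A closed set given by two linear inequalities contains the closure of a sector as soon as it
contains the unit vectors in it. -/
theorem closure_sector_subset {S : Set ℝ} {a b c d : ℝ}
    (h : ∀ θ ∈ S, 0 ≤ a * Real.cos θ + b * Real.sin θ ∧ 0 ≤ c * Real.cos θ + d * Real.sin θ) :
    closure (sector S) ⊆ {κ : ℂ | 0 ≤ a * κ.re + b * κ.im ∧ 0 ≤ c * κ.re + d * κ.im} := by
  refine closure_minimal ?_ ?_
  · rintro κ ⟨r, hr, θ, hθ, rfl⟩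
    obtain ⟨h1, h2⟩ := h θ hθ
    simp only [Set.mem_ofPred_eq, polar_re, polar_im]
    exact ⟨by nlinarith, by nlinarith⟩
  · exact (isClosed_le continuous_const (by fun_prop)).and
      (isClosed_le continuous_const (by fun_prop))

/-- The sector is cut out by the lines of slope `±√3` through the origin. Up to a positive factor,
the two linear forms are the sines of the angles measured from these lines. The next three lemmas
follow the same pattern. -/
theorem of_mem_closure_Omega1 {κ : ℂ} (h : κ ∈ closure Omega1) :
    Real.sqrt 3 * κ.re ≤ κ.im ∧ κ.im ≤ -(Real.sqrt 3 * κ.re) := by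
  have := closure_sector_subset (a := -Real.sqrt 3) (b := 1) (c := -Real.sqrt 3) (d := -1)
    (fun θ hθ => by
      have h1 := Real.sin_nonneg_of_nonneg_of_le_pi (x := θ - Real.pi / 3)
        (by linarith [hθ.1, Real.pi_pos]) (by linarith [hθ.2, Real.pi_pos])
      have h2 := Real.sin_nonneg_of_nonneg_of_le_pi (x := θ - 2 * Real.pi / 3)
        (by linarith [hθ.1, Real.pi_pos]) (by linarith [hθ.2, Real.pi_pos])
      constructor <;> linarith [sin_sub_third θ, sin_sub_two_thirds θ]) h
  constructor <;> linarith [this.1, this.2]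

theorem of_mem_closure_Omega2 {κ : ℂ} (h : κ ∈ closure Omega2) :
    κ.im ≤ Real.sqrt 3 * κ.re ∧ κ.im ≤ -(Real.sqrt 3 * κ.re) := by
  have := closure_sector_subset (a := Real.sqrt 3) (b := -1) (c := -Real.sqrt 3) (d := -1)
    (fun θ hθ => by
      have h1 := Real.sin_nonneg_of_nonneg_of_le_pi (x := θ + 2 * Real.pi / 3)
        (by linarith [hθ.1, Real.pi_pos]) (by linarith [hθ.2, Real.pi_pos])
      have h2 := Real.sin_nonpos_of_nonpos_of_neg_pi_le (x := θ + Real.pi / 3)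
        (by linarith [hθ.2, Real.pi_pos]) (by linarith [hθ.1, Real.pi_pos])
      constructor <;> linarith [sin_add_two_thirds θ, sin_add_third θ]) h
  constructor <;> linarith [this.1, this.2]

theorem of_mem_closure_Omega3 {κ : ℂ} (h : κ ∈ closure Omega3) :
    -(Real.sqrt 3 * κ.re) ≤ κ.im ∧ κ.im ≤ Real.sqrt 3 * κ.re := by
  have := closure_sector_subset (a := Real.sqrt 3) (b := 1) (c := Real.sqrt 3) (d := -1)
    (fun θ hθ => by
      have h1 := Real.sin_nonneg_of_nonneg_of_le_pi (x := θ + Real.pi / 3)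
        (by linarith [hθ.1, Real.pi_pos]) (by linarith [hθ.2, Real.pi_pos])
      have h2 := Real.sin_nonpos_of_nonpos_of_neg_pi_le (x := θ - Real.pi / 3)
        (by linarith [hθ.2, Real.pi_pos]) (by linarith [hθ.1, Real.pi_pos])
      constructor <;> linarith [sin_add_third θ, sin_sub_third θ]) h
  constructor <;> linarith [this.1, this.2]

theorem of_mem_closure_Omega4 {κ : ℂ} (h : κ ∈ closure Omega4) :
    -(Real.sqrt 3 * κ.re) ≤ κ.im ∧ Real.sqrt 3 * κ.re ≤ κ.im := by
  have := closure_sector_subset (a := Real.sqrt 3) (b := 1) (c := -Real.sqrt 3) (d := 1)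
    (fun θ hθ => by
      have h1 := Real.sin_nonneg_of_nonneg_of_le_pi (x := θ + Real.pi / 3)
        (by linarith [hθ.1, Real.pi_pos]) (by linarith [hθ.2, Real.pi_pos])
      have h2 := Real.sin_nonneg_of_nonneg_of_le_pi (x := θ - Real.pi / 3)
        (by linarith [hθ.1, Real.pi_pos]) (by linarith [hθ.2, Real.pi_pos])
      constructor <;> linarith [sin_add_third θ, sin_sub_third θ]) h
  constructor <;> linarith [this.1, this.2]

theorem of_mem_poleSector {κ : ℂ} (h : κ ∈ poleSector) :
    Real.sqrt 3 * κ.re < κ.im ∧ Real.sqrt 3 * κ.im ≤ κ.re ∧ κ.re < 0 ∧ κ.im < 0 := by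
  obtain ⟨r, hr, θ, hθ, rfl⟩ := h
  rw [polar_re, polar_im]
  have h1 := Real.sin_pos_of_pos_of_lt_pi (x := θ - Real.pi / 3)
    (by linarith [hθ.1, Real.pi_pos]) (by linarith [hθ.2, Real.pi_pos])
  have h2 := Real.sin_nonneg_of_nonneg_of_le_pi (x := θ - 7 * Real.pi / 6)
    (by linarith [hθ.1, Real.pi_pos]) (by linarith [hθ.2, Real.pi_pos])
  have e1 : Real.sqrt 3 * (r * Real.cos θ) < r * Real.sin θ := by
    nlinarith [sin_sub_third θ]
  have e2 : Real.sqrt 3 * (r * Real.sin θ) ≤ r * Real.cos θ := by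
    nlinarith [sin_sub_seven_sixths θ]
  have e3 : r * Real.cos θ < 0 := by
    nlinarith [sqrt_three_sq, sqrt_three_pos]
  exact ⟨e1, e2, e3, by nlinarith [sqrt_three_pos]⟩

theorem re_nonpos_of_mem_closure_Omega1 {κ : ℂ} (h : κ ∈ closure Omega1) : κ.re ≤ 0 := by
  have := of_mem_closure_Omega1 h
  nlinarith [sqrt_three_pos]

theorem re_nonneg_of_mem_closure_Omega3 {κ : ℂ} (h : κ ∈ closure Omega3) : 0 ≤ κ.re := by
  have := of_mem_closure_Omega3 h
  nlinarith [sqrt_three_pos]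

theorem mem_plusRegion_of_mem_poleSector {κ : ℂ} (h : κ ∈ poleSector) : κ ∈ plusRegion := by
  have := of_mem_poleSector h
  rw [mem_plusRegion]
  nlinarith [sqrt_three_pos, this.2.2.1]

theorem re_z_mul_pos {κ : ℂ} (h : κ ∈ poleSector) : 0 < (z * κ).re := by
  have := of_mem_poleSector h
  rw [Complex.mul_re, z_re, z_im]
  nlinarith [sqrt_three_pos, this.2.2.1]

theorem z_mul_mem_minusRegion {κ : ℂ} (h : κ ∈ poleSector) : z * κ ∈ minusRegion := by
  rw [minusRegion, Set.mem_ofPred_eq, inv_mul_cancel_left₀ z_ne_zero]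
  exact (of_mem_poleSector h).2.2.2

/-- This makes `χ(k_j)` decay as `x → -∞` and grow as `x → +∞`: `κ` lies in the left half plane and
`zκ` in the right one. -/
theorem re_z_sub_one_mul_pos {κ : ℂ} (h : κ ∈ poleSector) : 0 < ((z - 1) * κ).re := by
  have := of_mem_poleSector h
  have h1 := re_z_mul_pos h
  rw [sub_mul, Complex.sub_re, one_mul]
  linarith

theorem im_z_sub_one_mul_eq_zero_iff {κ : ℂ} (h : κ ∈ poleSector) :
    ((z - 1) * κ).im = 0 ↔ ∃ η : ℝ, 0 < η ∧ κ = Complex.I * z * η := by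
  have h1 := of_mem_poleSector h
  have h2 : ((z - 1) * κ).im = Real.sqrt 3 / 2 * (κ.re - Real.sqrt 3 * κ.im) := by
    rw [Complex.mul_im, Complex.sub_re, Complex.sub_im, z_re, z_im]
    simp only [Complex.one_re, Complex.one_im]
    linear_combination (κ.im / 2) * sqrt_three_sq
  rw [h2]
  constructor
  · intro h3
    have h4 : κ.re = Real.sqrt 3 * κ.im := by
      rcases mul_eq_zero.1 h3 with h | h
      · linarith [sqrt_three_pos]
      · linarith
    -- The imaginary part of `i z η` is `η Re z = -η/2`.
    refine ⟨-2 * κ.im, by linarith, Complex.ext ?_ ?_⟩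
    · simp [z_re, z_im]
      linarith
    · simp [z_re, z_im]
      ring
  · rintro ⟨η, -, rfl⟩
    simp [z_re, z_im]
    ring

variable {N : ℕ} {k : Fin N → ℂ}

theorem F_ne_zero (hk : ∀ j, k j ∈ poleSector) {κ : ℂ} (h : κ.re ≤ 0) : F k κ ≠ 0 := by
  refine Finset.prod_ne_zero_iff.2 fun j _ h0 => ?_
  have := congrArg Complex.re h0
  simp only [Complex.add_re, Complex.conj_re, Complex.zero_re] at this
  linarith [(of_mem_poleSector (hk j)).2.2.1]

theorem G_eq_zero_iff {κ : ℂ} : G k κ = 0 ↔ κ ∈ Set.range k := by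
  rw [G, Finset.prod_eq_zero_iff]
  simp [sub_eq_zero, eq_comm]

theorem notMem_range_of_re (hk : ∀ j, k j ∈ poleSector) {κ : ℂ} (h : 0 ≤ κ.re) :
    κ ∉ Set.range k := by
  rintro ⟨j, rfl⟩
  linarith [(of_mem_poleSector (hk j)).2.2.1]

theorem G_ne_zero (hk : ∀ j, k j ∈ poleSector) {κ : ℂ} (h : 0 ≤ κ.re) : G k κ ≠ 0 :=
  fun h0 => notMem_range_of_re hk h (G_eq_zero_iff.1 h0)

theorem G_ne_zero_of_mem_closure_minusRegion (hk : ∀ j, k j ∈ poleSector) {κ : ℂ}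
    (h : κ ∈ closure minusRegion) : G k κ ≠ 0 := by
  intro h0
  obtain ⟨j, rfl⟩ := G_eq_zero_iff.1 h0
  have h1 := mem_plusRegion.1 (mem_plusRegion_of_mem_poleSector (hk j))
  linarith [mem_closure_minusRegion.1 h]

theorem G_ne_zero_of_mem_closure_Omega (hk : ∀ j, k j ∈ poleSector) {κ : ℂ}
    (h : κ ∈ closure Omega2 ∪ closure Omega3 ∪ closure Omega4) : G k κ ≠ 0 := by
  rcases h with (h | h) | h
  · intro h0
    obtain ⟨j, rfl⟩ := G_eq_zero_iff.1 h0
    linarith [(of_mem_poleSector (hk j)).1, of_mem_closure_Omega2 h]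
  · exact G_ne_zero hk (re_nonneg_of_mem_closure_Omega3 h)
  · exact G_ne_zero_of_mem_closure_minusRegion hk
      (mem_closure_minusRegion.2 (of_mem_closure_Omega4 h).1)

theorem gam_ne_zero (hk : ∀ j, k j ∈ poleSector) {E : Fin N → ℂ} (hE : ∀ j, E j ≠ 0) (j : Fin N) :
    gam k E j ≠ 0 :=
  div_ne_zero (neg_ne_zero.2 (mul_ne_zero (F_ne_zero hk (of_mem_poleSector (hk j)).2.2.1.le)
    (hE j))) (G_ne_zero hk (re_z_mul_pos (hk j)).le)

end Geometry

/-! ### The linear system -/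

section LinearSystem

variable {N : ℕ} {k E : Fin N → ℂ}

theorem dotProduct_vecV (κ : ℂ) (a : Fin N → ℂ) :
    dotProduct (vecV N κ) a = ∑ c : Fin N, a c * κ ^ (c.rev : ℕ) := by
  simp only [dotProduct, vecV, mul_comm]

theorem matM_mulVec (x t : ℝ) (a : Fin N → ℂ) (j : Fin N) :
    Matrix.mulVec (matM k E x t) a j = dotProduct (vecV N (k j)) a
      + gam k E j * chi k j x t * dotProduct (vecV N (z * k j)) a := by
  simp only [Matrix.mulVec, dotProduct, vecV, matM, Matrix.of_apply, mEntry, Finset.mul_sum,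
    ← Finset.sum_add_distrib]
  exact Finset.sum_congr rfl fun c _ => by ring

theorem vecB_apply (x t : ℝ) (j : Fin N) :
    vecB k E x t j = k j ^ N + gam k E j * chi k j x t * (z * k j) ^ N := by
  rw [vecB, mEntry]
  ring

theorem system_iff_mulVec (x t : ℝ) (a : Fin N → ℂ) :
    (∀ j, k j ^ N + dotProduct (vecV N (k j)) a = -gam k E j * chi k j x t *
        ((z * k j) ^ N + dotProduct (vecV N (z * k j)) a)) ↔
      Matrix.mulVec (matM k E x t) a = -vecB k E x t := by
  rw [funext_iff]
  refine forall_congr' fun j => ?_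
  rw [matM_mulVec, Pi.neg_apply, vecB_apply]
  constructor <;> intro h <;> linear_combination h

theorem mulVec_eq_neg_iff {M : Matrix (Fin N) (Fin N) ℂ} (hM : M.det ≠ 0) (b a : Fin N → ℂ) :
    Matrix.mulVec M a = -b ↔ a = -Matrix.mulVec M⁻¹ b := by
  have hu : IsUnit M.det := isUnit_iff_ne_zero.2 hM
  constructor
  · intro h
    rw [← Matrix.mulVec_neg, ← h, Matrix.mulVec_mulVec, Matrix.nonsing_inv_mul _ hu,
      Matrix.one_mulVec]
  · rintro rfl
    rw [Matrix.mulVec_neg, Matrix.mulVec_mulVec, Matrix.mul_nonsing_inv _ hu, Matrix.one_mulVec]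

theorem cramer_of_mulVec {M : Matrix (Fin N) (Fin N) ℂ} (hM : M.det ≠ 0) {b a : Fin N → ℂ}
    (h : Matrix.mulVec M a = -b) (c : Fin N) : a c = -((M.updateCol c b).det / M.det) := by
  rw [(mulVec_eq_neg_iff hM b a).1 h, ← Matrix.cramer_apply, Matrix.cramer_eq_adjugate_mulVec,
    Matrix.inv_def, Ring.inverse_eq_inv', Matrix.smul_mulVec, Pi.neg_apply, Pi.smul_apply,
    smul_eq_mul, div_eq_inv_mul]

theorem vecA_spec {x t : ℝ} (h : (x, t) ∈ regularSet k E) :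
    Matrix.mulVec (matM k E x t) (vecA k E x t) = -vecB k E x t :=
  (mulVec_eq_neg_iff h _ _).2 rfl

theorem contDiff_chi (j : Fin N) : ContDiff ℝ ∞ fun p : ℝ × ℝ => chi k j p.1 p.2 := by
  unfold chi
  have h1 : ContDiff ℝ ∞ fun p : ℝ × ℝ => (p.1 : ℂ) := Complex.ofRealCLM.contDiff.comp contDiff_fst
  have h2 : ContDiff ℝ ∞ fun p : ℝ × ℝ => (p.2 : ℂ) := Complex.ofRealCLM.contDiff.comp contDiff_snd
  fun_prop

theorem contDiff_mEntry (l : ℕ) (j : Fin N) :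
    ContDiff ℝ ∞ fun p : ℝ × ℝ => mEntry k E l j p.1 p.2 := by
  unfold mEntry
  have := contDiff_chi (k := k) j
  fun_prop

theorem contDiff_det {X : Type*} [NormedAddCommGroup X] [NormedSpace ℝ X]
    {M : X → Matrix (Fin N) (Fin N) ℂ} (h : ∀ i j, ContDiff ℝ ∞ fun p => M p i j) :
    ContDiff ℝ ∞ fun p => (M p).det := by
  simp only [Matrix.det_apply']
  exact ContDiff.sum fun σ _ => contDiff_const.mul (contDiff_prod fun i _ => h _ _)

theorem contDiff_det_matM : ContDiff ℝ ∞ fun p : ℝ × ℝ => (matM k E p.1 p.2).det :=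
  contDiff_det fun i _ => contDiff_mEntry _ i

theorem isOpen_regularSet : IsOpen (regularSet k E) :=
  isOpen_ne_fun (contDiff_det_matM).continuous continuous_const

theorem vecA_cramer {x t : ℝ} (h : (x, t) ∈ regularSet k E) (c : Fin N) :
    vecA k E x t c = -(((matM k E x t).updateCol c (vecB k E x t)).det / (matM k E x t).det) :=
  cramer_of_mulVec h (vecA_spec h) c

theorem contDiffOn_vecA (c : Fin N) :
    ContDiffOn ℝ ∞ (fun p : ℝ × ℝ => vecA k E p.1 p.2 c) (regularSet k E) := by
  have h : ContDiff ℝ ∞ fun p : ℝ × ℝ =>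
      ((matM k E p.1 p.2).updateCol c (vecB k E p.1 p.2)).det := by
    refine contDiff_det fun i j => ?_
    simp only [Matrix.updateCol_apply]
    split_ifs
    · exact contDiff_mEntry _ i
    · exact contDiff_mEntry _ i
  exact ((h.contDiffOn.mul (contDiff_det_matM.contDiffOn.inv fun p hp => hp)).neg).congr
    fun p hp => (vecA_cramer hp c).trans (by rw [div_eq_mul_inv]; rfl)

/-- The Vandermonde matrix whose rows are `V(w_j)`. -/
def revVandermonde (w : Fin N → ℂ) : Matrix (Fin N) (Fin N) ℂ := Matrix.of fun j => vecV N (w j)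

theorem det_revVandermonde_ne_zero {w : Fin N → ℂ} (hw : Function.Injective w) :
    (revVandermonde w).det ≠ 0 := by
  have : revVandermonde w = (Matrix.vandermonde w).submatrix id Fin.revPerm := by
    ext i j
    simp [revVandermonde, vecV, Matrix.vandermonde_apply]
  rw [this, Matrix.det_permute']
  exact mul_ne_zero (by simp) (Matrix.det_vandermonde_ne_zero_iff.2 hw)

open Polynomial in
/-- The monic polynomial with prescribed lower coefficients. -/
def monicPoly {R : Type*} [CommRing R] (a : Fin N → R) : R[X] :=
  X ^ N + ∑ c : Fin N, C (a c) * X ^ (c.rev : ℕ)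

theorem monicPoly_eval {R : Type*} [CommRing R] (a : Fin N → R) (κ : R) :
    (monicPoly a).eval κ = κ ^ N + ∑ c : Fin N, a c * κ ^ (c.rev : ℕ) := by
  simp [monicPoly, Polynomial.eval_finsetSum]

theorem monicPoly_coeff_of_lt {R : Type*} [CommRing R] (a : Fin N → R) (c : Fin N) :
    (monicPoly a).coeff (c.rev : ℕ) = a c := by
  simp only [monicPoly, Polynomial.coeff_add, Polynomial.finsetSum_coeff,
    Polynomial.coeff_C_mul, Polynomial.coeff_X_pow]
  rw [if_neg (Fin.is_lt _).ne, zero_add, Finset.sum_eq_single c]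
  · simp
  · intro b _ hb
    rw [if_neg, mul_zero]
    intro h
    exact hb (Fin.rev_injective (Fin.ext h)).symm
  · simp

theorem monicPoly_coeff_of_le {R : Type*} [CommRing R] (a : Fin N → R) {i : ℕ} (hi : N ≤ i) :
    (monicPoly a).coeff i = if i = N then 1 else 0 := by
  simp only [monicPoly, Polynomial.coeff_add, Polynomial.finsetSum_coeff,
    Polynomial.coeff_C_mul, Polynomial.coeff_X_pow]
  rw [Finset.sum_eq_zero, add_zero]
  intro b _
  rw [if_neg ((Fin.is_lt _).trans_le hi).ne', mul_zero]

theorem eq_sum_rev_of_coeff_eq_zero {R : Type*} [CommRing R] {q : Polynomial R}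
    (hq : ∀ i, N ≤ i → q.coeff i = 0) (κ : R) :
    q.eval κ = ∑ c : Fin N, q.coeff (c.rev : ℕ) * κ ^ (c.rev : ℕ) := by
  have hd : q.degree < N := (Polynomial.degree_lt_iff_coeff_zero q N).2 hq
  by_cases h0 : q = 0
  · simp [h0]
  rw [Polynomial.eval_eq_sum_range' ((Polynomial.natDegree_lt_iff_degree_lt h0).2 hd),
    Finset.sum_range]
  exact (Equiv.sum_comp Fin.revPerm (fun c : Fin N => q.coeff (c : ℕ) * κ ^ (c : ℕ))).symm

/-- The polynomial `κ ^ N + V(κ) a` vanishing at `N` distinct points is the product. -/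
theorem monic_eq_prod {w : Fin N → ℂ} (hw : Function.Injective w) {a : Fin N → ℂ}
    (h : Matrix.mulVec (revVandermonde w) a = -fun j => w j ^ N) (κ : ℂ) :
    κ ^ N + dotProduct (vecV N κ) a = ∏ j, (κ - w j) := by
  rw [dotProduct_vecV, ← monicPoly_eval]
  -- Both polynomials are monic of degree `N`, so their difference has degree below `N`. It vanishes
  -- at the `N` distinct nodes, and the Vandermonde determinant forces it to be zero.
  set q : Polynomial ℂ := monicPoly a - ∏ j, (Polynomial.X - Polynomial.C (w j)) with hq
  have hprod : (∏ j, (Polynomial.X - Polynomial.C (w j))).natDegree = N := by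
    rw [Polynomial.natDegree_prod_of_monic _ _ fun j _ => Polynomial.monic_X_sub_C _]
    simp
  have hmon : (∏ j, (Polynomial.X - Polynomial.C (w j))).Monic :=
    Polynomial.monic_prod_of_monic _ _ fun j _ => Polynomial.monic_X_sub_C _
  have hq0 : ∀ i, N ≤ i → q.coeff i = 0 := by
    intro i hi
    rw [hq, Polynomial.coeff_sub, monicPoly_coeff_of_le a hi]
    rcases hi.eq_or_lt with rfl | hlt
    · have := hmon.coeff_natDegree
      rw [hprod] at this
      simp [this]
    · rw [if_neg hlt.ne', Polynomial.coeff_eq_zero_of_natDegree_lt (by rwa [hprod]), sub_zero]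
  have hz : Matrix.mulVec (revVandermonde w) (fun c => q.coeff (c.rev : ℕ)) = 0 := by
    funext j
    have e1 : q.eval (w j) = 0 := by
      have h1 := congrFun h j
      simp only [Pi.neg_apply] at h1
      rw [hq, Polynomial.eval_sub, monicPoly_eval, ← dotProduct_vecV]
      have h2 : dotProduct (vecV N (w j)) a = -w j ^ N := h1
      rw [h2, Polynomial.eval_prod, Finset.prod_eq_zero (Finset.mem_univ j) (by simp)]
      ring
    rw [eq_sum_rev_of_coeff_eq_zero hq0, ← dotProduct_vecV] at e1
    exact e1
  have hz' := Matrix.eq_zero_of_mulVec_eq_zero (det_revVandermonde_ne_zero hw) hz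
  have : q.eval κ = 0 := by
    rw [eq_sum_rev_of_coeff_eq_zero hq0]
    exact Finset.sum_eq_zero fun c _ => by rw [show q.coeff (c.rev : ℕ) = 0 from congrFun hz' c,
      zero_mul]
  rw [hq, Polynomial.eval_sub, sub_eq_zero, Polynomial.eval_prod] at this
  simpa using this

end LinearSystem

/-! ### Limits together with two derivatives -/

section Tame

open Filter

/-- `f → c` along `l`, and the first two derivatives of `f` tend to zero. -/
def Tame (l : Filter ℝ) (f : ℝ → ℂ) (c : ℂ) : Prop :=
  ∃ f1 f2 : ℝ → ℂ, (∀ᶠ x in l, HasDerivAt f (f1 x) x) ∧ (∀ᶠ x in l, HasDerivAt f1 (f2 x) x) ∧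
    Tendsto f l (𝓝 c) ∧ Tendsto f1 l (𝓝 0) ∧ Tendsto f2 l (𝓝 0)

/-- Eventual properties hold eventually in a neighbourhood. -/
def NhdsStable (l : Filter ℝ) : Prop :=
  ∀ P : ℝ → Prop, (∀ᶠ x in l, P x) → ∀ᶠ x in l, ∀ᶠ y in 𝓝 x, P y

theorem nhdsStable_atTop : NhdsStable atTop := fun P h => by
  obtain ⟨a, ha⟩ := eventually_atTop.1 h
  filter_upwards [eventually_gt_atTop a] with x hx
  filter_upwards [Ioi_mem_nhds hx] with y hy using ha y (le_of_lt hy)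

theorem nhdsStable_atBot : NhdsStable atBot := fun P h => by
  obtain ⟨a, ha⟩ := eventually_atBot.1 h
  filter_upwards [eventually_lt_atBot a] with x hx
  filter_upwards [Iio_mem_nhds hx] with y hy using ha y (le_of_lt hy)

variable {l : Filter ℝ} {f g : ℝ → ℂ} {a b : ℂ}

theorem Tame.tendsto (h : Tame l f a) : Tendsto f l (𝓝 a) := by
  obtain ⟨_, _, _, _, h, _⟩ := h
  exact h

theorem Tame.const (c : ℂ) : Tame l (fun _ => c) c :=
  ⟨fun _ => 0, fun _ => 0, .of_forall fun x => hasDerivAt_const x c,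
    .of_forall fun x => hasDerivAt_const x 0, tendsto_const_nhds, tendsto_const_nhds,
    tendsto_const_nhds⟩

theorem Tame.add (hf : Tame l f a) (hg : Tame l g b) : Tame l (fun x => f x + g x) (a + b) := by
  obtain ⟨f1, f2, h1, h2, h3, h4, h5⟩ := hf
  obtain ⟨g1, g2, k1, k2, k3, k4, k5⟩ := hg
  refine ⟨fun x => f1 x + g1 x, fun x => f2 x + g2 x, ?_, ?_, h3.add k3, ?_, ?_⟩
  · filter_upwards [h1, k1] with x hx kx using hx.add kx
  · filter_upwards [h2, k2] with x hx kx using hx.add kx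
  · simpa using h4.add k4
  · simpa using h5.add k5

theorem Tame.mul (hf : Tame l f a) (hg : Tame l g b) : Tame l (fun x => f x * g x) (a * b) := by
  obtain ⟨f1, f2, h1, h2, h3, h4, h5⟩ := hf
  obtain ⟨g1, g2, k1, k2, k3, k4, k5⟩ := hg
  refine ⟨fun x => f1 x * g x + f x * g1 x,
    fun x => (f2 x * g x + f1 x * g1 x) + (f1 x * g1 x + f x * g2 x), ?_, ?_, h3.mul k3, ?_, ?_⟩
  · filter_upwards [h1, k1] with x hx kx using hx.mul kx
  · filter_upwards [h1, k1, h2, k2] with x hx kx hx2 kx2 using (hx2.mul kx).add (hx.mul kx2)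
  · simpa using (h4.mul k3).add (h3.mul k4)
  · simpa using ((h5.mul k3).add (h4.mul k4)).add ((h4.mul k4).add (h3.mul k5))

theorem Tame.inv (hf : Tame l f a) (ha : a ≠ 0) : Tame l (fun x => (f x)⁻¹) a⁻¹ := by
  obtain ⟨f1, f2, h1, h2, h3, h4, h5⟩ := hf
  have h0 : ∀ᶠ x in l, f x ≠ 0 := h3.eventually_ne ha
  refine ⟨fun x => -f1 x / f x ^ 2,
    fun x => (-f2 x * f x ^ 2 - -f1 x * (2 * f x * f1 x)) / (f x ^ 2) ^ 2, ?_, ?_, h3.inv₀ ha, ?_, ?_⟩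
  · filter_upwards [h1, h0] with x hx hx0 using hx.inv hx0
  · filter_upwards [h1, h2, h0] with x hx hx2 hx0
    have : HasDerivAt (fun x => -f1 x / f x ^ 2) _ x :=
      hx2.neg.div (hx.pow 2) (pow_ne_zero 2 hx0)
    simpa using this
  · have : Tendsto (fun x => -f1 x / f x ^ 2) l (𝓝 (-0 / a ^ 2)) :=
      h4.neg.div (h3.pow 2) (pow_ne_zero 2 ha)
    simpa using this
  · have : Tendsto (fun x => (-f2 x * f x ^ 2 - -f1 x * (2 * f x * f1 x)) / (f x ^ 2) ^ 2) l _ :=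
      ((h5.neg.mul (h3.pow 2)).sub (h4.neg.mul ((tendsto_const_nhds (x := (2 : ℂ))).mul h3
      |>.mul h4))).div ((h3.pow 2).pow 2) (pow_ne_zero 2 (pow_ne_zero 2 ha))
    simpa using this

theorem Tame.div (hf : Tame l f a) (hg : Tame l g b) (hb : b ≠ 0) :
    Tame l (fun x => f x / g x) (a / b) := by
  simpa only [div_eq_mul_inv] using hf.mul (hg.inv hb)

theorem Tame.const_mul (c : ℂ) (hf : Tame l f a) : Tame l (fun x => c * f x) (c * a) :=
  (Tame.const c).mul hf

theorem Tame.neg (hf : Tame l f a) : Tame l (fun x => -f x) (-a) := by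
  simpa using hf.const_mul (-1)

theorem Tame.sum {ι : Type*} {s : Finset ι} {f : ι → ℝ → ℂ} {a : ι → ℂ}
    (h : ∀ i ∈ s, Tame l (f i) (a i)) : Tame l (fun x => ∑ i ∈ s, f i x) (∑ i ∈ s, a i) := by
  classical
  induction s using Finset.induction_on with
  | empty => simpa using Tame.const 0
  | insert i s hi ih =>
    simp only [Finset.sum_insert hi]
    exact (h i (by simp)).add (ih fun j hj => h j (by simp [hj]))

theorem Tame.prod {ι : Type*} {s : Finset ι} {f : ι → ℝ → ℂ} {a : ι → ℂ}
    (h : ∀ i ∈ s, Tame l (f i) (a i)) : Tame l (fun x => ∏ i ∈ s, f i x) (∏ i ∈ s, a i) := by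
  classical
  induction s using Finset.induction_on with
  | empty => simpa using Tame.const 1
  | insert i s hi ih =>
    simp only [Finset.prod_insert hi]
    exact (h i (by simp)).mul (ih fun j hj => h j (by simp [hj]))

theorem Tame.det {n : ℕ} {M : ℝ → Matrix (Fin n) (Fin n) ℂ} {M0 : Matrix (Fin n) (Fin n) ℂ}
    (h : ∀ i j, Tame l (fun x => M x i j) (M0 i j)) : Tame l (fun x => (M x).det) M0.det := by
  simp only [Matrix.det_apply']
  exact Tame.sum fun σ _ => Tame.const_mul _ (Tame.prod fun i _ => h _ _)

/-- Transferring a derivative at `x` needs equality near `x`, not only at `x`; this is what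
`NhdsStable` supplies. -/
theorem Tame.congr (hl : NhdsStable l) (hf : Tame l f a) (h : ∀ᶠ x in l, g x = f x) :
    Tame l g a := by
  obtain ⟨f1, f2, h1, h2, h3, h4, h5⟩ := hf
  refine ⟨f1, f2, ?_, h2, h3.congr' ?_, h4, h5⟩
  · filter_upwards [h1, hl _ h] with x hx hx'
    exact hx.congr_of_eventuallyEq hx'
  · filter_upwards [h] with x hx using hx.symm

theorem hasDerivAt_cexp_linear (c d : ℂ) (x : ℝ) :
    HasDerivAt (fun y : ℝ => Complex.exp (c * y + d)) (c * Complex.exp (c * x + d)) x := by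
  have h : HasDerivAt (fun y : ℝ => c * (y : ℂ) + d) c x := by
    simpa using ((Complex.ofRealCLM.hasDerivAt (x := x)).const_mul c).add_const d
  simpa [mul_comm] using h.cexp

theorem Tame.exp {c : ℂ} (d : ℂ) (h : Tendsto (fun x : ℝ => c.re * x) l atBot) :
    Tame l (fun x : ℝ => Complex.exp (c * x + d)) 0 := by
  have h0 : Tendsto (fun x : ℝ => Complex.exp (c * x + d)) l (𝓝 0) := by
    rw [tendsto_zero_iff_norm_tendsto_zero]
    simp only [Complex.norm_exp]
    refine Real.tendsto_exp_atBot.comp ?_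
    simpa using h.atBot_add (tendsto_const_nhds (x := d.re))
  refine ⟨fun x => c * Complex.exp (c * x + d), fun x => c * (c * Complex.exp (c * x + d)),
    .of_forall fun x => hasDerivAt_cexp_linear c d x,
    .of_forall fun x => (hasDerivAt_cexp_linear c d x).const_mul c, h0, ?_, ?_⟩
  · simpa using h0.const_mul c
  · simpa using (h0.const_mul c).const_mul c

/-- By Leibniz, `e^{-κx} ∂_x^n (e^{κx} q)` is `κ^n q` plus multiples of `q'` and `q''`, which tend
to zero. -/
theorem Tame.hasJostAsymptotics (hl : NhdsStable l) {q : ℝ → ℂ} (h : Tame l q 1) (κ : ℂ) :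
    HasJostAsymptotics l κ fun x => Complex.exp (κ * x) * q x := by
  obtain ⟨q1, q2, h1, h2, h3, h4, h5⟩ := h
  have he : ∀ x : ℝ, HasDerivAt (fun y : ℝ => Complex.exp (κ * y)) (κ * Complex.exp (κ * x)) x :=
    fun x => by simpa using hasDerivAt_cexp_linear κ 0 x
  have hinv : ∀ (x : ℝ) (c : ℂ), Complex.exp (-(κ * x)) * (Complex.exp (κ * x) * c) = c := by
    intro x c
    rw [← mul_assoc, ← Complex.exp_add]
    simp
  have d1 : ∀ᶠ x in l, deriv (fun y : ℝ => Complex.exp (κ * y) * q y) x =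
      Complex.exp (κ * x) * (κ * q x + q1 x) := by
    filter_upwards [h1] with x hx
    rw [((he x).fun_mul hx).deriv]
    ring
  intro n hn
  interval_cases n
  · simpa [hinv] using h3
  · have : Tendsto (fun x => κ * q x + q1 x) l (𝓝 (κ ^ 1)) := by
      simpa using (h3.const_mul κ).add h4
    refine this.congr' ?_
    filter_upwards [d1] with x hx
    rw [iteratedDeriv_one, hx, hinv]
  · have : Tendsto (fun x => κ ^ 2 * q x + 2 * κ * q1 x + q2 x) l (𝓝 (κ ^ 2)) := by
      simpa using ((h3.const_mul (κ ^ 2)).add (h4.const_mul (2 * κ))).add h5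
    refine this.congr' ?_
    filter_upwards [hl _ d1, h1, h2] with x hx hx1 hx2
    rw [iteratedDeriv_succ, iteratedDeriv_one, Filter.EventuallyEq.deriv_eq hx,
      ((he x).fun_mul ((hx1.const_mul κ).fun_add hx2)).deriv,
      show κ * Complex.exp (κ * x) * (κ * q x + q1 x) + Complex.exp (κ * x) * (κ * q1 x + q2 x) =
        Complex.exp (κ * x) * (κ ^ 2 * q x + 2 * κ * q1 x + q2 x) by ring, hinv]

variable {N : ℕ}

/-- The solution of a linear system that tends to a Vandermonde system. -/
theorem Tame.monic_prod (hl : NhdsStable l) {M : ℝ → Matrix (Fin N) (Fin N) ℂ}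
    {B v : ℝ → Fin N → ℂ} {w : Fin N → ℂ} (hw : Function.Injective w)
    (hM : ∀ i j, Tame l (fun x => M x i j) (revVandermonde w i j))
    (hB : ∀ j, Tame l (fun x => B x j) (w j ^ N))
    (h : ∀ᶠ x in l, (M x).det ≠ 0 → Matrix.mulVec (M x) (v x) = -B x) (κ : ℂ) :
    Tame l (fun x => κ ^ N + dotProduct (vecV N κ) (v x)) (∏ j, (κ - w j)) := by
  have h0 := det_revVandermonde_ne_zero hw
  have hdet := Tame.det hM
  set v0 : Fin N → ℂ := -Matrix.mulVec (revVandermonde w)⁻¹ fun j => w j ^ N with hv0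
  have hspec := (mulVec_eq_neg_iff h0 (fun j => w j ^ N) v0).2 hv0
  have hv : ∀ c, Tame l (fun x => v x c) (v0 c) := by
    intro c
    -- Cramer's rule writes each unknown as a quotient of determinants, so tameness passes from the
    -- matrix entries to the solution.
    rw [cramer_of_mulVec h0 hspec c]
    have h1 : Tame l (fun x => ((M x).updateCol c (B x)).det)
        ((revVandermonde w).updateCol c fun j => w j ^ N).det := by
      refine Tame.det fun i j => ?_
      simp only [Matrix.updateCol_apply]
      split_ifs
      · exact hB i
      · exact hM i j
    refine ((h1.div hdet h0).neg).congr hl ?_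
    filter_upwards [h, hdet.tendsto.eventually_ne h0] with x hx hx0
    exact cramer_of_mulVec hx0 (hx hx0) c
  rw [← monic_eq_prod hw hspec]
  simp only [dotProduct]
  exact (Tame.const _).add (Tame.sum fun c _ => (hv c).const_mul _)

end Tame

/-! ### Behaviour for large `|x|`, and density of the regular set -/

section Limits

open Filter

variable {N : ℕ} {k E : Fin N → ℂ}

theorem tame_chi_atBot (hk : ∀ j, k j ∈ poleSector) (j : Fin N) (t : ℝ) :
    Tame atBot (fun x => chi k j x t) 0 :=
  Tame.exp _ (Tendsto.const_mul_atBot (re_z_sub_one_mul_pos (hk j)) tendsto_id)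

theorem tame_mEntry_atBot (hk : ∀ j, k j ∈ poleSector) (m : ℕ) (j : Fin N) (t : ℝ) :
    Tame atBot (fun x => mEntry k E m j x t) (k j ^ m) := by
  have := (Tame.const (k j ^ m)).add
    ((tame_chi_atBot hk j t).const_mul ((z * k j) ^ m * gam k E j))
  rwa [mul_zero, add_zero] at this

theorem tame_monic_atBot (hk : ∀ j, k j ∈ poleSector) (hinj : Function.Injective k) (t : ℝ)
    (κ : ℂ) : Tame atBot (fun x => κ ^ N + dotProduct (vecV N κ) (vecA k E x t)) (G k κ) :=
  Tame.monic_prod nhdsStable_atBot hinj (M := fun x => matM k E x t) (B := fun x => vecB k E x t)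
    (fun i _ => tame_mEntry_atBot hk _ i t) (fun j => tame_mEntry_atBot hk N j t)
    (.of_forall fun _ hx => vecA_spec hx) κ

theorem chi_inv (j : Fin N) (x t : ℝ) : (chi k j x t)⁻¹ =
    Complex.exp (-((z - 1) * k j) * x + -(9 * (z ^ 2 - 1) * k j ^ 5 * t)) := by
  rw [chi, ← Complex.exp_neg]
  ring_nf

theorem tame_chi_inv_atTop (hk : ∀ j, k j ∈ poleSector) (j : Fin N) (t : ℝ) :
    Tame atTop (fun x => (chi k j x t)⁻¹) 0 := by
  simp only [chi_inv]
  refine Tame.exp _ (Tendsto.const_mul_atTop_of_neg ?_ tendsto_id)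
  simpa using re_z_sub_one_mul_pos (hk j)

/-- Each entry in row `j` grows like `γ(k_j) χ(k_j)`. Dividing the row by this factor leaves the
solution of the system unchanged and gives a finite limit, with node `z k_j` in place of `k_j`. -/
theorem tame_scaled_mEntry_atTop (hk : ∀ j, k j ∈ poleSector) (hE : ∀ j, E j ≠ 0) (m : ℕ)
    (j : Fin N) (t : ℝ) :
    Tame atTop (fun x => (gam k E j * chi k j x t)⁻¹ * mEntry k E m j x t) ((z * k j) ^ m) := by
  have h := ((tame_chi_inv_atTop hk j t).const_mul ((gam k E j)⁻¹ * k j ^ m)).add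
    (Tame.const ((z * k j) ^ m))
  rw [mul_zero, zero_add] at h
  refine h.congr nhdsStable_atTop (.of_forall fun x => ?_)
  have h1 := gam_ne_zero hk hE j
  have h2 : chi k j x t ≠ 0 := Complex.exp_ne_zero _
  rw [mEntry]
  field_simp

theorem tame_monic_atTop (hk : ∀ j, k j ∈ poleSector) (hinj : Function.Injective k)
    (hE : ∀ j, E j ≠ 0) (t : ℝ) (κ : ℂ) :
    Tame atTop (fun x => κ ^ N + dotProduct (vecV N κ) (vecA k E x t)) (∏ j, (κ - z * k j)) := by
  refine Tame.monic_prod nhdsStable_atTop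
    (fun _ _ h => hinj (mul_left_cancel₀ z_ne_zero h))
    (M := fun x => Matrix.diagonal (fun j => (gam k E j * chi k j x t)⁻¹) * matM k E x t)
    (B := fun x j => (gam k E j * chi k j x t)⁻¹ * vecB k E x t j)
    (fun i j => ?_) (fun j => tame_scaled_mEntry_atTop hk hE N j t)
    (.of_forall fun x hx => ?_) κ
  · simp only [Matrix.diagonal_mul]
    exact tame_scaled_mEntry_atTop hk hE _ i t
  · have hx' : (x, t) ∈ regularSet k E := by
      rw [Matrix.det_mul] at hx
      exact right_ne_zero_of_mul hx
    rw [← Matrix.mulVec_mulVec, vecA_spec hx', Matrix.mulVec_neg]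
    funext j
    simp [Matrix.mulVec_diagonal]

/-- For `k_j = i z η_j` one has `-z k_j = -i z² η_j`, which is the conjugate of `k_j` because `conj
z = z²`. -/
theorem prod_sub_z_mul_eq_F (h : ∀ j, ∃ η : ℝ, 0 < η ∧ k j = Complex.I * z * η) (κ : ℂ) :
    ∏ j, (κ - z * k j) = F k κ := by
  refine Finset.prod_congr rfl fun j _ => ?_
  obtain ⟨η, -, hη⟩ := h j
  have hc : conj z = z ^ 2 := by
    rw [z_sq]
    apply Complex.ext
    · simp only [Complex.conj_re, Complex.sub_re, Complex.neg_re, Complex.one_re, z_re]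
      norm_num
    · simp
  rw [hη, map_mul, map_mul, Complex.conj_I, hc, Complex.conj_ofReal]
  ring

theorem exp_neg_mul_numer_div (κ c : ℂ) (x t : ℝ) :
    Complex.exp (-(κ * x)) * (numer k E κ x t / c) =
      (κ ^ N + dotProduct (vecV N κ) (vecA k E x t)) / c := by
  rw [numer, mul_div_assoc, ← mul_assoc, ← Complex.exp_add]
  simp

theorem jost_numer_div {l : Filter ℝ} (hl : NhdsStable l) {κ c : ℂ} {t : ℝ} (hc : c ≠ 0)
    (h : Tame l (fun x => κ ^ N + dotProduct (vecV N κ) (vecA k E x t)) c) :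
    HasJostAsymptotics l κ fun x => numer k E κ x t / c := by
  have h1 := h.div (Tame.const c) hc
  rw [div_self hc] at h1
  simpa only [numer, mul_div_assoc] using h1.hasJostAsymptotics hl κ

theorem jost_atBot (hk : ∀ j, k j ∈ poleSector) (hinj : Function.Injective k) (t : ℝ) :
    (∀ κ ∈ closure Omega3, HasJostAsymptotics atBot κ (fun x => solg k E κ x t)) ∧
      (∀ κ ∈ closure Omega1,
        Tendsto (fun x : ℝ => Complex.exp (-(κ * x)) * solf k E κ x t) atBot (𝓝 (Tl k κ)⁻¹)) := by
  refine ⟨fun κ hκ => jost_numer_div nhdsStable_atBot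
    (G_ne_zero hk (re_nonneg_of_mem_closure_Omega3 hκ)) (tame_monic_atBot hk hinj t κ),
    fun κ _ => ?_⟩
  -- At `κ = k_j` division by zero gives `Tl = 0` and then inverse `0`. This agrees with `G / F`
  -- there, so no case distinction is needed.
  simp only [solf, exp_neg_mul_numer_div, Tl, inv_div]
  exact (tame_monic_atBot hk hinj t κ).tendsto.div_const _

theorem jost_atTop (hk : ∀ j, k j ∈ poleSector) (hinj : Function.Injective k)
    (hE : ∀ j, E j ≠ 0) (h : ∀ j, ∃ η : ℝ, 0 < η ∧ k j = Complex.I * z * η) (t : ℝ) :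
    (∀ κ ∈ closure Omega1, HasJostAsymptotics atTop κ (fun x => solf k E κ x t)) ∧
      (∀ κ ∈ closure Omega3,
        Tendsto (fun x : ℝ => Complex.exp (-(κ * x)) * solg k E κ x t) atTop (𝓝 (Tr k κ)⁻¹)) := by
  have ht := fun κ => tame_monic_atTop hk hinj hE t κ
  simp only [prod_sub_z_mul_eq_F h] at ht
  refine ⟨fun κ hκ => jost_numer_div nhdsStable_atTop
    (F_ne_zero hk (re_nonpos_of_mem_closure_Omega1 hκ)) (ht κ), fun κ _ => ?_⟩
  simp only [solg, exp_neg_mul_numer_div, Tr, inv_div]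
  exact (ht κ).tendsto.div_const _

theorem analyticAt_mEntry (m : ℕ) (j : Fin N) (t x : ℝ) :
    AnalyticAt ℝ (fun x => mEntry k E m j x t) x := by
  have h1 : AnalyticAt ℝ (fun x : ℝ => (z - 1) * k j * (x : ℂ) + 9 * (z ^ 2 - 1) * k j ^ 5 * t) x :=
    (analyticAt_const.mul (Complex.ofRealCLM.analyticAt x)).add analyticAt_const
  have h2 : AnalyticAt ℝ Complex.exp
      ((z - 1) * k j * (x : ℂ) + 9 * (z ^ 2 - 1) * k j ^ 5 * t) :=
    analyticAt_cexp.restrictScalars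
  exact analyticAt_const.add (analyticAt_const.mul (AnalyticAt.fun_comp h2 h1))

/-- The determinant is real analytic in `x` and tends to a nonzero Vandermonde determinant as `x →
-∞`. By the identity theorem it vanishes on no nonempty open set. -/
theorem dense_regular_slice (hk : ∀ j, k j ∈ poleSector) (hinj : Function.Injective k) (t : ℝ) :
    Dense {x : ℝ | (x, t) ∈ regularSet k E} := by
  have hanal : AnalyticOnNhd ℝ (fun x => (matM k E x t).det) Set.univ := by
    intro x _
    simp only [Matrix.det_apply']
    exact Finset.analyticAt_fun_sum _ fun σ _ => analyticAt_const.mul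
      (Finset.analyticAt_fun_prod _ fun i _ => analyticAt_mEntry _ _ t x)
  have hlim : Tendsto (fun x => (matM k E x t).det) atBot (𝓝 (revVandermonde k).det) :=
    (Tame.det fun i j => tame_mEntry_atBot hk _ i t).tendsto
  obtain ⟨x0, hx0⟩ := (hlim.eventually_ne (det_revVandermonde_ne_zero hinj)).exists
  rw [← compl_compl {x : ℝ | (x, t) ∈ regularSet k E}, ← interior_eq_empty_iff_dense_compl,
    Set.eq_empty_iff_forall_notMem]
  intro x hx
  have hz : (fun x => (matM k E x t).det) =ᶠ[𝓝 x] 0 := by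
    filter_upwards [mem_interior_iff_mem_nhds.1 hx] with y hy
    exact not_not.1 hy
  exact hx0 (hanal.eqOn_zero_of_preconnected_of_eventuallyEq_zero isPreconnected_univ
    (Set.mem_univ x) hz (Set.mem_univ x0))

theorem chi_real_iff (hk : ∀ j, k j ∈ poleSector) (j : Fin N) :
    (∀ x t : ℝ, (chi k j x t).im = 0) ↔ ∃ η : ℝ, 0 < η ∧ k j = Complex.I * z * η := by
  rw [← im_z_sub_one_mul_eq_zero_iff (hk j)]
  constructor
  · intro h
    by_contra hne
    -- At this `x`, with `t = 0`, the exponent has imaginary part `π/2`, so `χ` is purely imaginary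
    -- and nonzero.
    have h1 := h (Real.pi / 2 / ((z - 1) * k j).im) 0
    rw [chi, Complex.exp_im] at h1
    simp only [Complex.ofReal_zero, mul_zero, add_zero, Complex.im_mul_ofReal] at h1
    rw [mul_div_cancel₀ _ hne, Real.sin_pi_div_two, mul_one] at h1
    exact (Real.exp_pos _).ne' h1
  · intro h x t
    obtain ⟨η, -, hη⟩ := (im_z_sub_one_mul_eq_zero_iff (hk j)).1 h
    have h1 : (z - 1) * k j = (((z - 1) * k j).re : ℝ) := Complex.ext rfl (by simp [h])
    -- Uses `9(z² - 1) = -(z - 1)⁵`, which follows from `(z - 1)² = -3z` and `z³ = 1`. Reality of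
    -- the `x`-exponent thus forces reality of the `t`-exponent.
    have h2 : 9 * (z ^ 2 - 1) * k j ^ 5 = ((-((z - 1) * k j).re ^ 5 : ℝ) : ℂ) := by
      push_cast
      rw [← h1, hη]
      linear_combination (Complex.I * z * η) ^ 5 * (z ^ 3 - 6 * z ^ 2 + 15 * z - 10) * z_sq
    rw [chi, h1, h2, ← Complex.ofReal_mul, ← Complex.ofReal_mul, ← Complex.ofReal_add,
      ← Complex.ofReal_exp, Complex.ofReal_im]

end Limits

/-! ### The linear equation and the nonlinear system -/

section Potentials

variable {N : ℕ} (k E : Fin N → ℂ)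

/-- The differential ring of smooth functions on the regular set. -/
abbrev regRing : Type := smoothRing (regularSet k E)

/-- The derivation `∂/∂x` of `regRing`. -/
abbrev regDx : Derivation ℂ (regRing k E) (regRing k E) := dirD isOpen_regularSet (1, 0)

/-- The derivation `∂/∂t` of `regRing`. -/
abbrev regDt : Derivation ℂ (regRing k E) (regRing k E) := dirD isOpen_regularSet (0, 1)

/-- The functions `γ(k_j) χ(k_j)`. -/
def regChi (j : Fin N) : regRing k E :=
  smoothRing.ofFun (fun p => gam k E j * chi k j p.1 p.2)
    (contDiff_const.mul (contDiff_chi j)).contDiffOn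

/-- The monic polynomial `κ ^ N + V(κ) A`. -/
def regPoly : Polynomial (regRing k E) :=
  monicPoly fun c => smoothRing.ofFun (fun p => vecA k E p.1 p.2 c) (contDiffOn_vecA c)

/-- Evaluation at a point of the regular set. -/
def evalAt (p : regularSet k E) : regRing k E →+* ℂ :=
  (Pi.evalRingHom (fun _ => ℂ) p).comp (smoothRing (regularSet k E)).val.toRingHom

variable {k E}

theorem evalAt_apply (p : regularSet k E) (f : regRing k E) : evalAt k E p f = f.1 p := rfl

theorem evalAt_algebraMap (p : regularSet k E) (c : ℂ) :
    evalAt k E p (algebraMap ℂ (regRing k E) c) = c := rfl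

theorem evalAt_ext {f g : regRing k E} (h : ∀ p, evalAt k E p f = evalAt k E p g) : f = g :=
  Subtype.ext (funext h)

theorem evalAt_regPoly (κ : ℂ) (p : regularSet k E) :
    evalAt k E p ((regPoly k E).eval (algebraMap ℂ (regRing k E) κ)) =
      κ ^ N + dotProduct (vecV N κ) (vecA k E p.1.1 p.1.2) := by
  rw [regPoly, monicPoly_eval, dotProduct_vecV]
  simp only [map_add, map_sum, map_mul, map_pow, evalAt_algebraMap]
  rfl

/-- The bridge from the concrete construction to the algebra: membership is the linear system, and
the vanishing of low-degree solutions is `det M ≠ 0` at every regular point. -/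
theorem isDressed_regPoly : IsDressed (regDx k E) (regDt k E) N k (fun j => z * k j)
    (regChi k E) (regPoly k E) where
  comm a := dirD_comm _ _ _ a
  dx_chi j := dirD_fst_eq _ (f := fun p => gam k E j * chi k j p.1 p.2) (fun _ => rfl)
    fun x t hp => by
      have h := (hasDerivAt_cexp_linear ((z - 1) * k j) (9 * (z ^ 2 - 1) * k j ^ 5 * t) x).const_mul
        (gam k E j)
      refine h.congr_deriv ?_
      change _ = 1 * ((z * k j) ^ 1 - k j ^ 1) * (gam k E j * chi k j x t)
      rw [chi]
      ring
  dt_chi j := dirD_snd_eq _ (f := fun p => gam k E j * chi k j p.1 p.2) (fun _ => rfl)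
    fun x t hp => by
      have h := (hasDerivAt_cexp_linear (9 * (z ^ 2 - 1) * k j ^ 5) ((z - 1) * k j * x) t).const_mul
        (gam k E j)
      simp only [chi, add_comm _ (9 * (z ^ 2 - 1) * k j ^ 5 * _)]
      refine h.congr_deriv ?_
      change _ = 9 * ((z * k j) ^ 5 - k j ^ 5) * (gam k E j * chi k j x t)
      rw [chi, add_comm, mul_pow, show z ^ 5 = z ^ 2 by linear_combination z ^ 2 * z_cube]
      ring
  cube j := by rw [mul_pow, z_cube, one_mul]
  mem j := evalAt_ext fun p => by
    rw [map_add, map_mul, evalAt_regPoly, evalAt_regPoly, map_zero, evalAt_apply, regChi,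
      smoothRing.ofFun_apply]
    have := (system_iff_mulVec p.1.1 p.1.2 _).2 (vecA_spec p.2) j
    linear_combination this
  lead := by rw [regPoly, monicPoly_coeff_of_le _ le_rfl, if_pos rfl]
  high i hi := by rw [regPoly, monicPoly_coeff_of_le _ hi.le, if_neg hi.ne']
  eq_zero q hq h := by
    have key : ∀ p : regularSet k E, (fun c : Fin N => evalAt k E p (q.coeff (c.rev : ℕ))) = 0 := by
      intro p
      refine Matrix.eq_zero_of_mulVec_eq_zero (M := matM k E p.1.1 p.1.2) p.2 (funext fun j => ?_)
      have e := congrArg (evalAt k E p) (mem_dressing.1 hq j)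
      rw [eq_sum_rev_of_coeff_eq_zero h, eq_sum_rev_of_coeff_eq_zero h] at e
      simp only [map_add, map_sum, map_mul, map_pow, evalAt_algebraMap, map_zero] at e
      rw [matM_mulVec, dotProduct_vecV, dotProduct_vecV, Pi.zero_apply]
      exact e
    ext1 i
    rcases le_or_gt N i with hi | hi
    · rw [h i hi, Polynomial.coeff_zero]
    · rw [Polynomial.coeff_zero]
      refine evalAt_ext fun p => ?_
      have := congrFun (key p) (Fin.rev ⟨i, hi⟩)
      rw [Fin.rev_rev] at this
      rw [map_zero]
      exact this

theorem lowCoeff_monicPoly {R : Type*} [CommRing R] (a : Fin N → R) (c : ℕ) :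
    lowCoeff N (monicPoly a) (c + 1) = if h : c < N then a ⟨c, h⟩ else 0 := by
  rw [lowCoeff, Polynomial.coeff_X_pow_mul']
  split_ifs with h1 h2 h2
  · rw [← monicPoly_coeff_of_lt a ⟨c, h2⟩, Fin.val_rev]
    congr 1
    simp only
    omega
  · omega
  · omega
  · rfl

theorem evalAt_lowCoeff (c : ℕ) (p : regularSet k E) :
    (lowCoeff N (regPoly k E) (c + 1)).1 p = coeffA k E c p.1.1 p.1.2 := by
  rw [regPoly, lowCoeff_monicPoly _ c, coeffA]
  split_ifs <;> rfl

/-- The potential `Q` as an element of `regRing`. -/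
abbrev regQ (k E : Fin N → ℂ) : regRing k E := dressedQ (regDx k E) N (regPoly k E)

/-- The potential `P` as an element of `regRing`. -/
abbrev regP (k E : Fin N → ℂ) : regRing k E := dressedP (regDx k E) N (regPoly k E)

theorem iteratedDeriv_coeffA (c : ℕ) (n : ℕ) {x t : ℝ}
    (hp : (x, t) ∈ regularSet k E) : iteratedDeriv n (fun y => coeffA k E c y t) x =
      ((regDx k E)^[n] (lowCoeff N (regPoly k E) (c + 1))).1 ⟨(x, t), hp⟩ :=
  iteratedDeriv_fst _ (f := fun p => coeffA k E c p.1 p.2)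
    (fun p => (evalAt_lowCoeff c p).symm) n hp

theorem potQ_eq (p : regularSet k E) : potQ k E p.1.1 p.1.2 = (regQ k E).1 p := by
  rw [potQ, ← iteratedDeriv_one, iteratedDeriv_coeffA 0 1 p.2]
  change _ = evalAt k E p (regQ k E)
  simp only [regQ, dressedQ, map_mul, map_neg, map_ofNat]
  rfl

theorem potP_eq (p : regularSet k E) : potP k E p.1.1 p.1.2 = (regP k E).1 p := by
  rw [potP, ← iteratedDeriv_one, ← iteratedDeriv_one, iteratedDeriv_coeffA 0 1 p.2,
    iteratedDeriv_coeffA 0 2 p.2, iteratedDeriv_coeffA 1 1 p.2,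
    ← evalAt_lowCoeff 0 p]
  change _ = evalAt k E p (regP k E)
  simp only [regP, dressedP, map_mul, map_sub, map_ofNat]
  rfl

theorem isClassicalSolutionOn : IsClassicalSolutionOn (potQ k E) (potP k E) (regularSet k E) := by
  refine ⟨?_, ?_, fun x t hp => ?_⟩
  · exact ContDiffOn.congr (regQ k E).2 fun p hp => by
      rw [extZero_apply _ hp, potQ_eq ⟨p, hp⟩]
  · exact ContDiffOn.congr (regP k E).2 fun p hp => by
      rw [extZero_apply _ hp, potP_eq ⟨p, hp⟩]
  · obtain ⟨h1, h2⟩ := (isDressed_regPoly (k := k) (E := E)).system (Q := regQ k E) (P := regP k E) rfl rfl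
    have hq : ∀ n, iteratedDeriv n (fun y => potQ k E y t) x =
        evalAt k E ⟨(x, t), hp⟩ ((regDx k E)^[n] (regQ k E)) := fun n =>
      iteratedDeriv_fst _ (f := fun p => potQ k E p.1 p.2) potQ_eq n hp
    have hp' : ∀ n, iteratedDeriv n (fun y => potP k E y t) x =
        evalAt k E ⟨(x, t), hp⟩ ((regDx k E)^[n] (regP k E)) := fun n =>
      iteratedDeriv_fst _ (f := fun p => potP k E p.1 p.2) potP_eq n hp
    have hqt : deriv (fun s => potQ k E x s) t =
        evalAt k E ⟨(x, t), hp⟩ (regDt k E (regQ k E)) :=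
      (hasDerivAt_snd isOpen_regularSet (f := fun p => potQ k E p.1 p.2) potQ_eq hp).deriv
    have hpt : deriv (fun s => potP k E x s) t =
        evalAt k E ⟨(x, t), hp⟩ (regDt k E (regP k E)) :=
      (hasDerivAt_snd isOpen_regularSet (f := fun p => potP k E p.1 p.2) potP_eq hp).deriv
    have e1 := congrArg (evalAt k E ⟨(x, t), hp⟩) h1
    have e2 := congrArg (evalAt k E ⟨(x, t), hp⟩) h2
    generalize evalAt k E ⟨(x, t), hp⟩ = ev at *
    simp only [map_add ev, map_sub ev, map_mul ev, map_pow ev, map_zero ev, map_ofNat ev] at e1 e2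
    simp only [SolvesSystem, hq, hp', hqt, hpt, Function.iterate_succ, Function.iterate_zero,
      Function.comp_apply, id_eq]
    exact ⟨by linear_combination e1, by linear_combination e2⟩

/-- The map `q ↦ c⁻¹ e^{κx} q(κ)` intertwines the twisted derivation on polynomials with `∂_x`, so
it carries `lax_x` to the differential equation. The constant `c` is arbitrary, which treats the
denominators `F(κ)` and `G(κ)` alike. -/
theorem solvesLinear_numer_div (κ c : ℂ) {x t : ℝ} (hp : (x, t) ∈ regularSet k E) :
    SolvesLinear (fun y => potQ k E y t) (fun y => potP k E y t) κ
      (fun y => numer k E κ y t / c) x := by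
  have hcd : ContDiff ℝ ∞ fun p : ℝ × ℝ => c⁻¹ * Complex.exp (κ * p.1) := by
    have h1 : ContDiff ℝ ∞ fun p : ℝ × ℝ => (p.1 : ℂ) :=
      Complex.ofRealCLM.contDiff.comp contDiff_fst
    fun_prop
  let e : regRing k E := smoothRing.ofFun _ hcd.contDiffOn
  have he : regDx k E e = algebraMap ℂ _ κ * e :=
    dirD_fst_eq _ (f := fun p => c⁻¹ * Complex.exp (κ * p.1)) (fun _ => rfl) fun x t hp => by
      have h := (hasDerivAt_cexp_linear κ 0 x).const_mul c⁻¹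
      simp only [add_zero] at h
      refine h.congr_deriv ?_
      change _ = κ * (c⁻¹ * Complex.exp (κ * x))
      ring
  let ev : Polynomial (regRing k E) → regRing k E := fun q => e * q.eval (algebraMap ℂ _ κ)
  have hev : ∀ q, regDx k E (ev q) = ev (twistD (regDx k E) 1 1 q) := by
    intro q
    simp only [ev, eval_twistD, Derivation.leibniz, smul_eq_mul, he, one_mul, pow_one]
    ring
  have hnum : ∀ p : regularSet k E, numer k E κ p.1.1 p.1.2 / c = (ev (regPoly k E)).1 p := by
    intro p
    change _ = evalAt k E p (ev (regPoly k E))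
    simp only [ev, map_mul, evalAt_regPoly]
    change _ = c⁻¹ * Complex.exp (κ * p.1.1) * _
    rw [numer]
    ring
  have hD : ∀ n, iteratedDeriv n (fun y => numer k E κ y t / c) x =
      evalAt k E ⟨(x, t), hp⟩ ((regDx k E)^[n] (ev (regPoly k E))) := fun n =>
    iteratedDeriv_fst _ (f := fun p => numer k E κ p.1 p.2 / c) hnum n hp
  have hlax := congrArg (fun q => evalAt k E ⟨(x, t), hp⟩ (ev q))
    (isDressed_regPoly (k := k) (E := E)).lax_x
  have h0 := hD 0
  rw [iteratedDeriv_zero] at h0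
  rw [SolvesLinear, ← iteratedDeriv_one, hD, hD, h0, potQ_eq ⟨(x, t), hp⟩, potP_eq ⟨(x, t), hp⟩]
  simp only [Function.iterate_succ, Function.iterate_zero, Function.comp_apply, id_eq, hev]
  simp only [ev, Polynomial.eval_add, Polynomial.eval_mul, Polynomial.eval_C, Polynomial.eval_pow,
    Polynomial.eval_X, map_add, map_mul, map_pow, evalAt_algebraMap] at hlax ⊢
  rw [← evalAt_apply, ← evalAt_apply]
  linear_combination hlax

end Potentials

/-! ### Expansion at infinity -/

section Expansion

open Filter Asymptotics

/-- `f(w) = 1 + a w + b w² + O(w³)` as `w → 0`. -/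
def Expands (f : ℂ → ℂ) (a b : ℂ) : Prop :=
  (fun w => f w - (1 + a * w + b * w ^ 2)) =O[𝓝 0] fun w => w ^ 3

theorem isBigO_pow_three_of_continuousAt {g : ℂ → ℂ} (hg : ContinuousAt g 0) :
    (fun w => g w * w ^ 3) =O[𝓝 0] fun w : ℂ => w ^ 3 := by
  simpa using (hg.isBigO_one ℂ).mul (isBigO_refl (fun w : ℂ => w ^ 3) (𝓝 0))

theorem Expands.mul {f g : ℂ → ℂ} {a b a' b' : ℂ} (hf : Expands f a b) (hg : Expands g a' b') :
    Expands (fun w => f w * g w) (a + a') (b + b' + a * a') := by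
  have hc : Tendsto (fun w : ℂ => 1 + a * w + b * w ^ 2) (𝓝 0) (𝓝 1) := by
    have : Continuous fun w : ℂ => 1 + a * w + b * w ^ 2 := by fun_prop
    simpa using this.tendsto 0
  have hg1 : g =O[𝓝 0] fun _ => (1 : ℂ) := by
    have h1 : (fun w : ℂ => w ^ 3) =O[𝓝 0] fun _ => (1 : ℂ) :=
      ((continuous_pow 3).continuousAt (x := (0 : ℂ))).isBigO_one ℂ
    have h2 : (fun w : ℂ => 1 + a' * w + b' * w ^ 2) =O[𝓝 0] fun _ => (1 : ℂ) :=
      Filter.Tendsto.isBigO_one ℂ (Continuous.tendsto (by fun_prop) 0)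
    exact ((IsBigO.trans hg h1).add h2).congr_left fun w => by ring
  have e1 := IsBigO.mul hf hg1
  have e2 := IsBigO.mul (hc.isBigO_one ℂ) hg
  simp only [mul_one, one_mul] at e1 e2
  have e3 := isBigO_pow_three_of_continuousAt (g := fun w => a * b' + b * a' + b * b' * w)
    (by fun_prop)
  refine ((e1.add e2).add e3).congr_left fun w => ?_
  ring

theorem Expands.inv_linear (c : ℂ) : Expands (fun w => (1 + c * w)⁻¹) (-c) (c ^ 2) := by
  have hc : ContinuousAt (fun w : ℂ => 1 + c * w) 0 := by fun_prop
  have h0 : ∀ᶠ w in 𝓝 (0 : ℂ), 1 + c * w ≠ 0 := hc.eventually_ne (by simp)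
  have h1 := isBigO_pow_three_of_continuousAt (g := fun w => -c ^ 3 * (1 + c * w)⁻¹)
    (continuousAt_const.mul (hc.inv₀ (by simp)))
  refine h1.congr' ?_ EventuallyEq.rfl
  filter_upwards [h0] with w hw
  field_simp
  ring

/-- The coefficients are, up to sign, the complete homogeneous symmetric polynomials of degrees one
and two, the latter written in power sums to make the induction a `ring` identity. -/
theorem Expands.prod_inv_linear {ι : Type*} (s : Finset ι) (c : ι → ℂ) :
    Expands (fun w => ∏ j ∈ s, (1 + c j * w)⁻¹) (-∑ j ∈ s, c j)
      (((∑ j ∈ s, c j) ^ 2 + ∑ j ∈ s, c j ^ 2) / 2) := by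
  classical
  induction s using Finset.induction_on with
  | empty =>
    simp only [Expands, Finset.prod_empty, Finset.sum_empty]
    simpa using isBigO_zero _ _
  | insert i s hi ih =>
    simp only [Finset.prod_insert hi, Finset.sum_insert hi]
    convert (Expands.inv_linear (c i)).mul ih using 1 <;> ring

theorem Expands.sub_one_isBigO {f : ℂ → ℂ} {a b : ℂ} (hf : Expands f a b) :
    (fun w => f w - 1) =O[𝓝 0] fun w => w := by
  have h1 : (fun w : ℂ => w ^ 3) =O[𝓝 0] fun w => w := by
    simpa [pow_succ] using ((((continuous_pow 2).continuousAt (x := (0 : ℂ))).isBigO_one ℂ).mul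
      (isBigO_refl (fun w : ℂ => w) (𝓝 0)))
  have h2 : (fun w : ℂ => (a + b * w) * w) =O[𝓝 0] fun w => w := by
    have : ContinuousAt (fun w : ℂ => a + b * w) 0 := by fun_prop
    simpa using (this.isBigO_one ℂ).mul (isBigO_refl (fun w : ℂ => w) (𝓝 0))
  refine ((IsBigO.trans hf h1).add h2).congr_left fun w => ?_
  ring

variable {N : ℕ} {k E : Fin N → ℂ}

theorem sum_ite_eq_coeffA (m : ℕ) (x t : ℝ) :
    ∑ c : Fin N, (if (c : ℕ) = m then vecA k E x t c else 0) = coeffA k E m x t := by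
  rw [coeffA]
  split_ifs with h
  · rw [Finset.sum_eq_single ⟨m, h⟩]
    · simp
    · intro b _ hb
      exact if_neg fun h' => hb (Fin.ext h')
    · simp
  · refine Finset.sum_eq_zero fun c _ => if_neg ?_
    rintro rfl
    exact h c.2

theorem expands_numerator (x t : ℝ) :
    Expands (fun w => 1 + ∑ c : Fin N, vecA k E x t c * w ^ ((c : ℕ) + 1))
      (coeffA k E 0 x t) (coeffA k E 1 x t) := by
  have h : (fun w : ℂ => ∑ c : Fin N, (vecA k E x t c * w ^ ((c : ℕ) + 1)
      - (if (c : ℕ) = 0 then vecA k E x t c else 0) * w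
      - (if (c : ℕ) = 1 then vecA k E x t c else 0) * w ^ 2)) =O[𝓝 0] fun w => w ^ 3 := by
    refine IsBigO.fun_sum fun c _ => ?_
    rcases (show (c : ℕ) = 0 ∨ (c : ℕ) = 1 ∨ ∃ m, (c : ℕ) = m + 2 by
      rcases (c : ℕ) with _ | _ | m <;> simp) with h | h | ⟨m, h⟩
    · simpa [h] using isBigO_zero _ _
    · simpa [h] using isBigO_zero _ _
    · have := isBigO_pow_three_of_continuousAt (g := fun w => vecA k E x t c * w ^ m)
        (by fun_prop)
      refine this.congr_left fun w => ?_
      simp only [h, show ¬(m + 2 = 0) by omega, show ¬(m + 2 = 1) by omega, if_false]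
      ring
  refine h.congr_left fun w => ?_
  rw [Finset.sum_sub_distrib, Finset.sum_sub_distrib, ← Finset.sum_mul, ← Finset.sum_mul,
    sum_ite_eq_coeffA, sum_ite_eq_coeffA]
  ring

/-- The quotient of `κ ^ N + V(κ) A` by a product, in the variable `w = 1 / κ`. -/
theorem numerator_div_prod_eq (c : Fin N → ℂ) (x t : ℝ) {κ : ℂ} (hκ : κ ≠ 0) :
    (κ ^ N + dotProduct (vecV N κ) (vecA k E x t)) / ∏ j, (κ + c j) =
      (1 + ∑ i : Fin N, vecA k E x t i * κ⁻¹ ^ ((i : ℕ) + 1)) * ∏ j, (1 + c j * κ⁻¹)⁻¹ := by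
  have h1 : ∏ j, (κ + c j) = κ ^ N * ∏ j, (1 + c j * κ⁻¹) := by
    rw [← Fin.prod_const, ← Finset.prod_mul_distrib]
    refine Finset.prod_congr rfl fun j _ => ?_
    field_simp
  have h2 : κ ^ N + dotProduct (vecV N κ) (vecA k E x t) =
      κ ^ N * (1 + ∑ i : Fin N, vecA k E x t i * κ⁻¹ ^ ((i : ℕ) + 1)) := by
    rw [dotProduct_vecV, mul_add, mul_one, Finset.mul_sum]
    congr 1
    refine Finset.sum_congr rfl fun i _ => ?_
    have : κ ^ N = κ ^ (i.rev : ℕ) * κ ^ ((i : ℕ) + 1) := by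
      rw [← pow_add, Fin.val_rev]
      congr 1
      omega
    rw [this, inv_pow]
    field_simp
  rw [h1, h2, mul_div_mul_left _ _ (pow_ne_zero _ hκ), Finset.prod_inv_distrib, div_eq_mul_inv]

theorem expands_quotient (c : Fin N → ℂ) (x t : ℝ) :
    Expands (fun w => (1 + ∑ i : Fin N, vecA k E x t i * w ^ ((i : ℕ) + 1)) *
      ∏ j, (1 + c j * w)⁻¹) (coeffA k E 0 x t - ∑ j, c j)
      (coeffA k E 1 x t - (∑ j, c j) * coeffA k E 0 x t
        + ((∑ j, c j) ^ 2 + ∑ j, c j ^ 2) / 2) := by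
  convert (expands_numerator (k := k) (E := E) x t).mul
    (Expands.prod_inv_linear Finset.univ c) using 1 <;> ring

/-- Symmetrizing the sum over `i ≤ j` counts every off-diagonal pair once and the diagonal twice in
the full double sum. -/
theorem sum_mul_sum_Ici (c : Fin N → ℂ) :
    ∑ i, c i * ∑ j ∈ Finset.Ici i, c j = ((∑ j, c j) ^ 2 + ∑ j, c j ^ 2) / 2 := by
  have e1 : ∑ i, c i * ∑ j ∈ Finset.Ici i, c j = ∑ i, ∑ j, if i ≤ j then c i * c j else 0 := by
    refine Finset.sum_congr rfl fun i _ => ?_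
    rw [Finset.mul_sum, ← Finset.sum_filter]
    refine Finset.sum_congr ?_ fun _ _ => rfl
    ext j
    simp
  have e2 : ∑ i, ∑ j, (if i ≤ j then c i * c j else 0) =
      ∑ i, ∑ j, if j ≤ i then c i * c j else 0 := by
    rw [Finset.sum_comm]
    simp only [mul_comm]
  have e3 : ∑ j, c j ^ 2 = ∑ i, ∑ j, if i = j then c i * c j else 0 := by
    refine Finset.sum_congr rfl fun i _ => ?_
    rw [Finset.sum_ite_eq]
    simp [pow_two]
  have e4 : (∑ j, c j) ^ 2 + ∑ j, c j ^ 2 =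
      (∑ i, ∑ j, if i ≤ j then c i * c j else 0) + ∑ i, ∑ j, if j ≤ i then c i * c j else 0 := by
    rw [e3, pow_two, Finset.sum_mul_sum, ← Finset.sum_add_distrib, ← Finset.sum_add_distrib]
    refine Finset.sum_congr rfl fun i _ => ?_
    rw [← Finset.sum_add_distrib, ← Finset.sum_add_distrib]
    refine Finset.sum_congr rfl fun j _ => ?_
    rcases lt_trichotomy i j with h | h | h
    · simp [h.le, h.ne, h.not_ge]
    · simp [h]
    · simp [h.le, h.ne', h.not_ge]
  rw [e4, ← e2, e1]
  ring

theorem solf_expansion (x t : ℝ) (l : Filter ℂ) :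
    (fun κ : ℂ => Complex.exp (-(κ * x)) * solf k E κ x t
        - (1 + u1 k E x t / κ + u2 k E x t / κ ^ 2))
      =O[Bornology.cobounded ℂ ⊓ l] fun κ => (κ ^ 3)⁻¹ := by
  have h := (expands_quotient (k := k) (E := E) (fun j => conj (k j)) x t).comp_tendsto
    tendsto_inv₀_cobounded
  refine IsBigO.mono (h.congr' ?_ ?_) inf_le_left
  · filter_upwards [Bornology.eventually_ne_cobounded (0 : ℂ)] with κ hκ
    simp only [Function.comp_apply, solf, exp_neg_mul_numer_div, F,
      numerator_div_prod_eq _ _ _ hκ, u1, u2, sigmaN, piN, sum_mul_sum_Ici]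
    simp only [inv_pow, div_eq_mul_inv]
  · exact .of_forall fun κ => by simp

theorem Phi_asymptotics (x t : ℝ) (l : Filter ℂ) :
    (fun κ : ℂ => Complex.exp (-(κ * x)) * Phi k E κ x t - 1)
      =O[Bornology.cobounded ℂ ⊓ l] fun κ => κ⁻¹ := by
  have h := (expands_quotient (k := k) (E := E) (fun j => -k j) x t).sub_one_isBigO.comp_tendsto
    tendsto_inv₀_cobounded
  refine IsBigO.mono (h.congr' ?_ ?_) inf_le_left
  · filter_upwards [Bornology.eventually_ne_cobounded (0 : ℂ)] with κ hκ
    simp only [Function.comp_apply, Phi, exp_neg_mul_numer_div, G, sub_eq_add_neg,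
      numerator_div_prod_eq _ _ _ hκ]
  · exact .of_forall fun κ => by simp

theorem differentiableAt_coeffA (c : ℕ) {x t : ℝ} (hp : (x, t) ∈ regularSet k E) :
    DifferentiableAt ℝ (fun y => coeffA k E c y t) x :=
  (hasDerivAt_fst isOpen_regularSet (f := fun p => coeffA k E c p.1 p.2)
    (fun p => (evalAt_lowCoeff c p).symm) hp).differentiableAt

theorem deriv_u1 (t : ℝ) :
    deriv (fun y => u1 k E y t) = deriv fun y => coeffA k E 0 y t := by
  funext x
  simp only [u1, deriv_sub_const]

theorem potQ_eq_u1 (x t : ℝ) : potQ k E x t = -3 * deriv (fun y => u1 k E y t) x := by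
  rw [deriv_u1, potQ]

/-- The constant shift in `u1` adds `-Σ_N A_{N-1}'` to `u1 u1'`, and the same term enters `u2'`; the
two cancel. -/
theorem potP_eq_u {x t : ℝ} (hp : (x, t) ∈ regularSet k E) :
    potP k E x t = 3 * (u1 k E x t * deriv (fun y => u1 k E y t) x
      - iteratedDeriv 2 (fun y => u1 k E y t) x - deriv (fun y => u2 k E y t) x) := by
  have h2 : deriv (fun y => u2 k E y t) x = deriv (fun y => coeffA k E 1 y t) x
      - sigmaN k * deriv (fun y => coeffA k E 0 y t) x :=
    (((differentiableAt_coeffA 1 hp).hasDerivAt.sub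
      ((differentiableAt_coeffA 0 hp).hasDerivAt.const_mul (sigmaN k))).add_const (piN k)).deriv
  rw [potP, iteratedDeriv_succ, iteratedDeriv_one, iteratedDeriv_succ, iteratedDeriv_one,
    deriv_u1, h2, u1]
  ring

end Expansion

/-! ### Holomorphy across a line, and entire functions of polynomial growth -/

section ComplexAnalysis

open Complex Metric Set Filter Asymptotics
open scoped Interval

/-- The sign condition keeps the open rectangle off the real axis. Cauchy–Goursat then applies with
mere continuity up to the boundary, so an edge may lie on the axis. -/
theorem boundary_integral_eq_zero_of_im_mul_nonneg {f : ℂ → ℂ} {U : Set ℂ} (hc : ContinuousOn f U)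
    (hd : ∀ w ∈ U, w.im ≠ 0 → DifferentiableAt ℂ f w) {a b : ℂ}
    (hR : [[a.re, b.re]] ×ℂ [[a.im, b.im]] ⊆ U) (hab : 0 ≤ a.im * b.im) :
    (∫ x : ℝ in a.re..b.re, f (x + a.im * I)) - (∫ x : ℝ in a.re..b.re, f (x + b.im * I)) +
      I • (∫ y : ℝ in a.im..b.im, f (b.re + y * I)) -
      I • (∫ y : ℝ in a.im..b.im, f (a.re + y * I)) = 0 := by
  refine integral_boundary_rect_eq_zero_of_continuousOn_of_differentiableOn f a b (hc.mono hR)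
    fun w hw => (hd w (hR ?_) ?_).differentiableWithinAt
  · exact ⟨Ioo_subset_Icc_self hw.1, Ioo_subset_Icc_self hw.2⟩
  · intro h0
    have h2 : w.im ∈ Ioo (min a.im b.im) (max a.im b.im) := hw.2
    rw [h0] at h2
    have h3 := min_lt_iff.1 h2.1
    have h4 := lt_max_iff.1 h2.2
    rcases h3 with h3 | h3 <;> rcases h4 with h4 | h4 <;> nlinarith

theorem intervalIntegrable_vertical {f : ℂ → ℂ} {U : Set ℂ} (hc : ContinuousOn f U) {r c d : ℝ}
    (h : ∀ y ∈ [[c, d]], (r + y * I : ℂ) ∈ U) :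
    IntervalIntegrable (fun y : ℝ => f (r + y * I)) MeasureTheory.volume c d :=
  (hc.comp (by fun_prop) h).intervalIntegrable

/-- A function continuous on a disc and holomorphic off the real axis is holomorphic. -/
theorem differentiableOn_ball_of_off_real {f : ℂ → ℂ} {c : ℂ} {r : ℝ}
    (hc : ContinuousOn f (ball c r)) (hd : ∀ w ∈ ball c r, w.im ≠ 0 → DifferentiableAt ℂ f w) :
    DifferentiableOn ℂ f (ball c r) := by
  refine (IsConservativeOn.isExactOn_ball hc ?_).differentiableOn isOpen_ball
  intro a b hab
  rw [← add_eq_zero_iff_eq_neg, wedgeIntegral_add_wedgeIntegral_eq]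
  rcases le_or_gt 0 (a.im * b.im) with h | h
  · exact boundary_integral_eq_zero_of_im_mul_nonneg hc hd hab h
  · have h0 : (0 : ℝ) ∈ [[a.im, b.im]] := by
      rw [mem_uIcc]
      rcases mul_neg_iff.1 h with h | h
      · exact Or.inr ⟨h.2.le, h.1.le⟩
      · exact Or.inl ⟨h.1.le, h.2.le⟩
    have s1 : [[a.im, 0]] ⊆ [[a.im, b.im]] := uIcc_subset_uIcc_left h0
    have s2 : [[0, b.im]] ⊆ [[a.im, b.im]] := uIcc_subset_uIcc_right h0
    have hmem : ∀ x ∈ [[a.re, b.re]], ∀ y ∈ [[a.im, b.im]], (x + y * I : ℂ) ∈ ball c r :=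
      fun x hx y hy => hab ⟨by simpa using hx, by simpa using hy⟩
    -- A rectangle that crosses the axis is cut along it; the integrals over the common edge cancel
    -- in the sum `e1 + e2`.
    have e1 := boundary_integral_eq_zero_of_im_mul_nonneg hc hd (a := a) (b := (b.re : ℂ))
      ((reProdIm_subset_iff.2 (prod_mono (by simp) (by simpa using s1))).trans hab) (by simp)
    have e2 := boundary_integral_eq_zero_of_im_mul_nonneg hc hd (a := (a.re : ℂ)) (b := b)
      ((reProdIm_subset_iff.2 (prod_mono (by simp) (by simpa using s2))).trans hab) (by simp)
    simp only [ofReal_re, ofReal_im] at e1 e2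
    rw [← intervalIntegral.integral_add_adjacent_intervals
        (intervalIntegrable_vertical hc fun y hy => hmem _ right_mem_uIcc y (s1 hy))
        (intervalIntegrable_vertical hc fun y hy => hmem _ right_mem_uIcc y (s2 hy)),
      ← intervalIntegral.integral_add_adjacent_intervals
        (intervalIntegrable_vertical hc fun y hy => hmem _ left_mem_uIcc y (s1 hy))
        (intervalIntegrable_vertical hc fun y hy => hmem _ left_mem_uIcc y (s2 hy))]
    simp only [smul_eq_mul] at e1 e2 ⊢
    linear_combination e1 + e2

theorem differentiableAt_of_off_line {f : ℂ → ℂ} {U : Set ℂ} (hU : IsOpen U)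
    (hc : ContinuousOn f U) {c : ℂ} (hc0 : c ≠ 0)
    (hd : ∀ w ∈ U, (c⁻¹ * w).im ≠ 0 → DifferentiableAt ℂ f w) {κ : ℂ} (hκ : κ ∈ U) :
    DifferentiableAt ℂ f κ := by
  have hV : IsOpen ((fun w => c * w) ⁻¹' U) := hU.preimage (by fun_prop)
  have hmem : c⁻¹ * κ ∈ (fun w => c * w) ⁻¹' U := by
    rwa [mem_preimage, mul_inv_cancel_left₀ hc0]
  obtain ⟨r, hr, hball⟩ := Metric.isOpen_iff.1 hV _ hmem
  have h1 : DifferentiableOn ℂ (fun w => f (c * w)) (ball (c⁻¹ * κ) r) := by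
    refine differentiableOn_ball_of_off_real (hc.comp (by fun_prop) hball) fun w hw him => ?_
    have h2 : DifferentiableAt ℂ f (c * w) :=
      hd _ (hball hw) (by rwa [inv_mul_cancel_left₀ hc0])
    exact h2.comp w (by fun_prop)
  have h2 : DifferentiableAt ℂ (fun w => f (c * w)) (c⁻¹ * κ) :=
    h1.differentiableAt (ball_mem_nhds _ hr)
  have h3 : f = (fun w => f (c * w)) ∘ fun w => c⁻¹ * w := by
    funext w
    simp [hc0]
  rw [h3]
  exact h2.comp κ (by fun_prop)

/-- An entire function that is `O(κ ^ (N - 1))` at infinity is a polynomial of degree `< N`. -/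
theorem eq_polynomial_of_isBigO (N : ℕ) {d : ℂ → ℂ} (hd : Differentiable ℂ d)
    (hO : d =O[Bornology.cobounded ℂ] fun κ => κ ^ N * κ⁻¹) :
    ∃ q : Polynomial ℂ, (∀ i, N ≤ i → q.coeff i = 0) ∧ ∀ κ, d κ = q.eval κ := by
  induction N generalizing d with
  | zero =>
    simp only [pow_zero, one_mul] at hO
    have h0 : Tendsto d (cocompact ℂ) (𝓝 0) := by
      rw [← Metric.cobounded_eq_cocompact]
      exact hO.trans_tendsto tendsto_inv₀_cobounded
    exact ⟨0, by simp, fun κ => by simpa using hd.apply_eq_of_tendsto_cocompact κ h0⟩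
  | succ N ih =>
    have hne := Bornology.eventually_ne_cobounded (0 : ℂ)
    -- The quotient `(d(κ) - d(0)) / κ`, completed at zero, is entire and grows one power slower.
    -- The induction ends with a function tending to zero at infinity, which Liouville's theorem
    -- kills.
    have hd1 : Differentiable ℂ (dslope d 0) := by
      rw [← differentiableOn_univ] at hd ⊢
      exact (differentiableOn_dslope univ_mem).2 hd
    have hslope : ∀ κ, κ ≠ 0 → dslope d 0 κ = d κ * κ⁻¹ - d 0 * κ⁻¹ := by
      intro κ hκ
      rw [dslope_of_ne _ hκ, slope_def_field, sub_zero]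
      field_simp
    have hbig : (fun κ : ℂ => d 0 * κ⁻¹) =O[Bornology.cobounded ℂ] fun κ => κ ^ N * κ⁻¹ := by
      have : (fun _ : ℂ => d 0) =O[Bornology.cobounded ℂ] fun κ => κ ^ N := by
        refine IsBigO.of_bound ‖d 0‖ ?_
        filter_upwards [(tendsto_norm_cobounded_atTop (E := ℂ)).eventually_ge_atTop 1] with κ hκ
        rw [norm_pow]
        exact le_mul_of_one_le_right (norm_nonneg _) (one_le_pow₀ hκ)
      exact this.mul (isBigO_refl _ _)
    obtain ⟨q, hq, hqd⟩ := ih hd1 (by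
      refine ((hO.mul (isBigO_refl (fun κ : ℂ => κ⁻¹) _)).congr' .rfl ?_).sub hbig |>.congr' ?_ .rfl
      · filter_upwards [hne] with κ hκ
        field_simp
        ring
      · filter_upwards [hne] with κ hκ using (hslope κ hκ).symm)
    refine ⟨Polynomial.C (d 0) + Polynomial.X * q, fun i hi => ?_, fun κ => ?_⟩
    · obtain ⟨m, rfl⟩ : ∃ m, i = m + 1 := ⟨i - 1, by omega⟩
      simp [hq m (by omega)]
    · simp only [Polynomial.eval_add, Polynomial.eval_C, Polynomial.eval_mul, Polynomial.eval_X,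
        ← hqd]
      by_cases hκ : κ = 0
      · simp [hκ]
      · rw [hslope κ hκ]
        field_simp
        ring

/-- A function analytic off a set and with removable singularities on it agrees off the set with
an entire function. -/
theorem exists_entire_eq {h : ℂ → ℂ} {S : Set ℂ} (ha : ∀ κ, κ ∉ S → AnalyticAt ℂ h κ)
    (hm : ∀ κ ∈ S, MeromorphicAt h κ ∧ 0 ≤ meromorphicOrderAt h κ) :
    ∃ H : ℂ → ℂ, Differentiable ℂ H ∧ ∀ κ, κ ∉ S → H κ = h κ := by
  have hmero : MeromorphicOn h univ := fun κ _ => by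
    by_cases hκ : κ ∈ S
    · exact (hm κ hκ).1
    · exact (ha κ hκ).meromorphicAt
  have hord : ∀ κ, 0 ≤ meromorphicOrderAt h κ := fun κ => by
    by_cases hκ : κ ∈ S
    · exact (hm κ hκ).2
    · exact (ha κ hκ).meromorphicOrderAt_nonneg
  -- Passing to the normal form corrects the arbitrary values of `h` on `S`; nonnegative order
  -- everywhere then means analyticity.
  have hH : ∀ κ, AnalyticAt ℂ (toMeromorphicNFOn h univ) κ := fun κ => by
    have := meromorphicNFOn_toMeromorphicNFOn h univ (mem_univ κ)
    rw [← this.meromorphicOrderAt_nonneg_iff_analyticAt,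
      meromorphicOrderAt_toMeromorphicNFOn hmero (mem_univ κ)]
    exact hord κ
  refine ⟨toMeromorphicNFOn h univ, fun κ => (hH κ).differentiableAt, fun κ hκ => ?_⟩
  have h1 := hmero.toMeromorphicNFOn_eq_self_on_nhdsNE (mem_univ κ)
  exact (((ha κ hκ).continuousAt.eventuallyEq_nhds_iff_eventuallyEq_nhdsNE
    (hH κ).continuousAt).1 h1.symm).eq_of_nhds.symm

end ComplexAnalysis

/-! ### The Riemann–Hilbert problem -/

section RiemannHilbert

open Filter Asymptotics

variable {N : ℕ} {k E : Fin N → ℂ} {x t : ℝ}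

theorem differentiable_numer (x t : ℝ) : Differentiable ℂ fun κ => numer k E κ x t := by
  unfold numer
  simp only [dotProduct_vecV]
  fun_prop

theorem differentiable_G : Differentiable ℂ (G k) := by
  unfold G
  fun_prop

theorem differentiable_F : Differentiable ℂ (F k) := by
  unfold F
  fun_prop

/-- The bound-state relation for a numerator `e^{κx} (κ^N + V(κ) a)` is one row of the system. -/
theorem bound_state_iff (hk : ∀ j, k j ∈ poleSector) (x t : ℝ) (j : Fin N) (P P' : ℂ) :
    Complex.exp (k j * x) * P / F k (k j) =
        depConst k E j t * (Complex.exp (z * k j * x) * P' / G k (z * k j)) ↔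
      P = -gam k E j * chi k j x t * P' := by
  have hF := F_ne_zero hk (of_mem_poleSector (hk j)).2.2.1.le
  have hG := G_ne_zero hk (re_z_mul_pos (hk j)).le
  have hchi : Complex.exp (9 * (z ^ 2 - 1) * k j ^ 5 * t) * Complex.exp (z * k j * x) =
      Complex.exp (k j * x) * chi k j x t := by
    rw [chi, ← Complex.exp_add, ← Complex.exp_add]
    ring_nf
  have hexp := Complex.exp_ne_zero (k j * x)
  have e : depConst k E j t * (Complex.exp (z * k j * x) * P' / G k (z * k j)) =
      Complex.exp (k j * x) * (-gam k E j * chi k j x t * P') / F k (k j) := by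
    rw [depConst, gam]
    field_simp
    linear_combination E j * P' * hchi
  rw [e, div_left_inj' hF, mul_right_inj' hexp]

theorem solf_bound_state (hk : ∀ j, k j ∈ poleSector) (hp : (x, t) ∈ regularSet k E) (j : Fin N) :
    solf k E (k j) x t = depConst k E j t * solg k E (z * k j) x t :=
  (bound_state_iff hk x t j _ _).2 ((system_iff_mulVec x t _).2 (vecA_spec hp) j)

theorem eventually_notMem_range (κ : ℂ) : ∀ᶠ w in 𝓝[≠] κ, w ∉ Set.range k := by
  have h : (Set.range k \ {κ}).Finite := (Set.finite_range k).subset Set.sdiff_subset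
  have h1 : (Set.range k \ {κ})ᶜ ∈ 𝓝 κ := h.isClosed.isOpen_compl.mem_nhds (by simp)
  filter_upwards [mem_nhdsWithin_of_mem_nhds h1, self_mem_nhdsWithin] with w hw hne hmem
  exact hw ⟨hmem, hne⟩

theorem G_eq_mul (j : Fin N) (κ : ℂ) :
    G k κ = (κ - k j) * ∏ i ∈ Finset.univ.erase j, (κ - k i) :=
  (Finset.mul_prod_erase _ _ (Finset.mem_univ j)).symm

theorem Phi_pole (hinj : Function.Injective k) (x t : ℝ) (j : Fin N) :
    MeromorphicAt (fun κ => Phi k E κ x t) (k j) ∧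
      (-1 : WithTop ℤ) ≤ meromorphicOrderAt (fun κ => Phi k E κ x t) (k j) := by
  have h0 : ∏ i ∈ Finset.univ.erase j, (k j - k i) ≠ 0 :=
    Finset.prod_ne_zero_iff.2 fun i hi => sub_ne_zero.2 fun h =>
      (Finset.ne_of_mem_erase hi) (hinj h).symm
  have hr : AnalyticAt ℂ
      (fun κ => numer k E κ x t * (∏ i ∈ Finset.univ.erase j, (κ - k i))⁻¹) (k j) :=
    ((differentiable_numer x t).analyticAt _).mul
      (AnalyticAt.inv (Differentiable.analyticAt (by fun_prop) _) h0)
  have hs : MeromorphicAt (fun κ : ℂ => (κ - k j) ^ (-1 : ℤ)) (k j) := by fun_prop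
  have e : (fun κ => Phi k E κ x t) = (fun κ => (κ - k j) ^ (-1 : ℤ)) *
      fun κ => numer k E κ x t * (∏ i ∈ Finset.univ.erase j, (κ - k i))⁻¹ := by
    funext κ
    rw [Pi.mul_apply, Phi, G_eq_mul j, div_eq_mul_inv, mul_inv, zpow_neg_one]
    ring
  rw [e]
  refine ⟨hs.mul hr.meromorphicAt, ?_⟩
  rw [meromorphicOrderAt_mul hs hr.meromorphicAt, fun_meromorphicOrderAt_zpow_id_sub_const]
  have := hr.meromorphicOrderAt_nonneg
  calc (-1 : WithTop ℤ) = ((-1 : ℤ) : WithTop ℤ) + 0 := by simp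
    _ ≤ _ := by gcongr

theorem Phi_isRHSolution (hk : ∀ j, k j ∈ poleSector) (hinj : Function.Injective k)
    (hp : (x, t) ∈ regularSet k E) :
    IsRHSolution k E x t (fun κ => Phi k E κ x t) (fun κ => Phi k E κ x t) where
  plus_holo κ hκ := ((differentiable_numer x t κ).div (differentiable_G κ) fun h =>
    hκ.2 (G_eq_zero_iff.1 h)).differentiableWithinAt
  plus_cont κ hκ := ((differentiable_numer x t κ).div (differentiable_G κ) fun h =>
    hκ.2 (G_eq_zero_iff.1 h)).continuousAt.continuousWithinAt
  plus_pole j := Phi_pole hinj x t j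
  minus_holo κ hκ := ((differentiable_numer x t κ).div (differentiable_G κ)
    (G_ne_zero_of_mem_closure_minusRegion hk (subset_closure hκ))).differentiableWithinAt
  minus_cont κ hκ := ((differentiable_numer x t κ).div (differentiable_G κ)
    (G_ne_zero_of_mem_closure_minusRegion hk hκ)).continuousAt.continuousWithinAt
  jump _ _ := rfl
  plus_asymp := Phi_asymptotics x t _
  minus_asymp := Phi_asymptotics x t _
  bound_state j := by
    have hF := F_ne_zero hk (of_mem_poleSector (hk j)).2.2.1.le
    have h1 : ContinuousAt (fun κ => solf k E κ x t) (k j) :=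
      ((differentiable_numer x t _).div (differentiable_F _) hF).continuousAt
    have h2 := h1.tendsto.mono_left (nhdsWithin_le_nhds (s := {k j}ᶜ))
    rw [solf_bound_state hk hp] at h2
    refine h2.congr' ?_
    filter_upwards [eventually_notMem_range (k := k) (k j)] with κ hκ
    have hG : G k κ ≠ 0 := fun h => hκ (G_eq_zero_iff.1 h)
    rw [solf, Phi, Tl, div_div_div_cancel_right₀ hG]

/-- The sectionally defined function of a solution of the Riemann–Hilbert problem. -/
def gluePM (Φp Φm : ℂ → ℂ) (κ : ℂ) : ℂ :=
  open Classical in if κ ∈ closure plusRegion then Φp κ else Φm κ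

variable {Φp Φm : ℂ → ℂ}

theorem gluePM_plus {κ : ℂ} (h : κ ∈ closure plusRegion) : gluePM Φp Φm κ = Φp κ := if_pos h

/-- The two closed half planes overlap exactly in the line, where the jump condition makes the
choice of branch immaterial. -/
theorem gluePM_minus (hs : IsRHSolution k E x t Φp Φm) {κ : ℂ} (h : κ ∈ closure minusRegion) :
    gluePM Φp Φm κ = Φm κ := by
  by_cases h' : κ ∈ closure plusRegion
  · rw [gluePM_plus h']
    refine hs.jump κ (mem_lineL.2 ?_)
    rw [closure_plusRegion] at h'
    rw [closure_minusRegion] at h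
    exact le_antisymm h h'
  · exact if_neg h'

theorem closure_union (κ : ℂ) : κ ∈ closure plusRegion ∨ κ ∈ closure minusRegion := by
  rw [closure_plusRegion, closure_minusRegion]
  exact le_total (0 : ℝ) _

theorem isOpen_plusRegion : IsOpen plusRegion := isOpen_lt continuous_const (by fun_prop)

theorem isOpen_minusRegion : IsOpen minusRegion := isOpen_lt (by fun_prop) continuous_const

theorem isOpen_compl_range : IsOpen (Set.range k)ᶜ := (Set.finite_range k).isClosed.isOpen_compl

theorem continuousOn_gluePM (hs : IsRHSolution k E x t Φp Φm) :
    ContinuousOn (gluePM Φp Φm) (Set.range k)ᶜ := by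
  intro κ hκ
  refine ContinuousAt.continuousWithinAt ?_
  rw [← continuousWithinAt_univ, show (Set.univ : Set ℂ) = closure plusRegion ∪ closure minusRegion
    from (Set.eq_univ_of_forall closure_union).symm]
  refine ContinuousWithinAt.union ?_ ?_
  · by_cases h : κ ∈ closure plusRegion
    · have h1 : ContinuousWithinAt Φp (closure plusRegion) κ :=
        (hs.plus_cont κ ⟨h, hκ⟩).mono_of_mem_nhdsWithin
          (inter_mem self_mem_nhdsWithin
            (mem_nhdsWithin_of_mem_nhds (isOpen_compl_range.mem_nhds hκ)))
      exact h1.congr (fun _ hy => gluePM_plus hy) (gluePM_plus h)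
    · exact continuousWithinAt_of_notMem_closure (by rwa [closure_closure])
  · by_cases h : κ ∈ closure minusRegion
    · exact (hs.minus_cont κ h).congr (fun _ hy => gluePM_minus hs hy) (gluePM_minus hs h)
    · exact continuousWithinAt_of_notMem_closure (by rwa [closure_closure])

theorem differentiableAt_gluePM (hs : IsRHSolution k E x t Φp Φm) {κ : ℂ} (hκ : κ ∉ Set.range k) :
    DifferentiableAt ℂ (gluePM Φp Φm) κ := by
  refine differentiableAt_of_off_line isOpen_compl_range (continuousOn_gluePM hs) z_ne_zero
    (fun w hw him => ?_) hκ
  rcases lt_or_gt_of_ne him with h | h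
  · have h1 : DifferentiableAt ℂ Φm w :=
      hs.minus_holo.differentiableAt (isOpen_minusRegion.mem_nhds h)
    refine h1.congr_of_eventuallyEq ?_
    filter_upwards [isOpen_minusRegion.mem_nhds h] with y hy using
      gluePM_minus hs (subset_closure hy)
  · have h1 : DifferentiableAt ℂ Φp w := hs.plus_holo.differentiableAt
      ((isOpen_plusRegion.inter isOpen_compl_range).mem_nhds ⟨h, hw⟩)
    refine h1.congr_of_eventuallyEq ?_
    filter_upwards [isOpen_plusRegion.mem_nhds h] with y hy using gluePM_plus (subset_closure hy)

theorem gluePM_asymp (hs : IsRHSolution k E x t Φp Φm) :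
    (fun κ : ℂ => Complex.exp (-(κ * x)) * gluePM Φp Φm κ - 1) =O[Bornology.cobounded ℂ]
      fun κ => κ⁻¹ := by
  have h1 : Bornology.cobounded ℂ = Bornology.cobounded ℂ ⊓ 𝓟 (closure plusRegion) ⊔
      Bornology.cobounded ℂ ⊓ 𝓟 (closure minusRegion) := by
    rw [← inf_sup_left, sup_principal, Set.eq_univ_of_forall (s := _ ∪ _) closure_union,
      principal_univ, inf_top_eq]
  rw [h1]
  refine IsBigO.sup (hs.plus_asymp.congr' ?_ .rfl) (hs.minus_asymp.congr' ?_ .rfl)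
  · filter_upwards [mem_inf_of_right (mem_principal_self _)] with κ hκ
    rw [gluePM_plus hκ]
  · filter_upwards [mem_inf_of_right (mem_principal_self _)] with κ hκ
    rw [gluePM_minus hs hκ]

/-- The simple zeros of `G` at the `k_j` absorb the simple poles of the plus function, and the glued
function is already holomorphic elsewhere. -/
theorem exists_entire_of_isRHSolution (hk : ∀ j, k j ∈ poleSector)
    (hs : IsRHSolution k E x t Φp Φm) :
    ∃ H : ℂ → ℂ, Differentiable ℂ H ∧ ∀ κ, κ ∉ Set.range k →
      H κ = G k κ * (Complex.exp (-(κ * x)) * gluePM Φp Φm κ) := by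
  refine exists_entire_eq (fun κ hκ => ?_) ?_
  · have : DifferentiableOn ℂ (fun κ => G k κ * (Complex.exp (-(κ * x)) * gluePM Φp Φm κ))
        (Set.range k)ᶜ := fun w hw => by
      have h1 := differentiableAt_gluePM hs hw
      have h2 := differentiable_G (k := k) w
      exact (h2.mul (DifferentiableAt.mul (by fun_prop) h1)).differentiableWithinAt
    exact this.analyticAt (isOpen_compl_range.mem_nhds hκ)
  · rintro _ ⟨j, rfl⟩
    obtain ⟨hm, ho⟩ := hs.plus_pole j
    have hr : AnalyticAt ℂ (fun κ : ℂ => (∏ i ∈ Finset.univ.erase j, (κ - k i)) *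
        Complex.exp (-(κ * x))) (k j) := Differentiable.analyticAt (by fun_prop) _
    have hl : MeromorphicAt (fun κ : ℂ => κ - k j) (k j) := by fun_prop
    have e : (fun κ => G k κ * (Complex.exp (-(κ * x)) * gluePM Φp Φm κ)) =ᶠ[𝓝[≠] k j]
        (fun κ => κ - k j) * ((fun κ => (∏ i ∈ Finset.univ.erase j, (κ - k i)) *
          Complex.exp (-(κ * x))) * Φp) := by
      filter_upwards [mem_nhdsWithin_of_mem_nhds
        (isOpen_plusRegion.mem_nhds (mem_plusRegion_of_mem_poleSector (hk j)))] with κ hκ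
      rw [gluePM_plus (subset_closure hκ), G_eq_mul j]
      simp only [Pi.mul_apply]
      ring
    refine ⟨(hl.mul (hr.meromorphicAt.mul hm)).congr e.symm, ?_⟩
    rw [meromorphicOrderAt_congr e, meromorphicOrderAt_mul hl (hr.meromorphicAt.mul hm),
      meromorphicOrderAt_mul hr.meromorphicAt hm]
    have h1 : meromorphicOrderAt (fun κ : ℂ => κ - k j) (k j) = 1 :=
      meromorphicOrderAt_id_sub_const
    rw [h1]
    have h2 := hr.meromorphicOrderAt_nonneg
    calc (0 : WithTop ℤ) = 1 + (0 + (-1)) := by norm_cast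
      _ ≤ _ := by gcongr

theorem isBigO_G : G k =O[Bornology.cobounded ℂ] fun κ => κ ^ N := by
  have h : ∀ j, (fun κ : ℂ => κ - k j) =O[Bornology.cobounded ℂ] fun κ => κ := fun j => by
    refine (isBigO_refl _ _).sub (IsBigO.of_bound ‖k j‖ ?_)
    filter_upwards [(tendsto_norm_cobounded_atTop (E := ℂ)).eventually_ge_atTop 1] with κ hκ
    exact le_mul_of_one_le_right (norm_nonneg _) hκ
  have := IsBigO.finsetProd (s := Finset.univ) fun j _ => h j
  change (fun κ => ∏ j, (κ - k j)) =O[Bornology.cobounded ℂ] _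
  simpa using this

/-- Asymptotics and pole orders reduce any solution to a monic polynomial of degree `N` over `G`.
The bound-state relations then determine its coefficients by the invertible linear system. -/
theorem numerator_of_isRHSolution (hk : ∀ j, k j ∈ poleSector) (hinj : Function.Injective k)
    (hp : (x, t) ∈ regularSet k E) (hs : IsRHSolution k E x t Φp Φm) {κ : ℂ}
    (hκ : κ ∉ Set.range k) : gluePM Φp Φm κ = Phi k E κ x t := by
  obtain ⟨H, hH, hHG⟩ := exists_entire_of_isRHSolution hk hs
  have hO : (fun κ => H κ - G k κ) =O[Bornology.cobounded ℂ] fun κ => κ ^ N * κ⁻¹ := by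
    refine ((isBigO_G (k := k)).mul (gluePM_asymp hs)).congr' ?_ .rfl
    have : ∀ᶠ κ in Bornology.cobounded ℂ, κ ∉ Set.range k :=
      (Set.finite_range k).isBounded
    filter_upwards [this] with κ hκ
    rw [hHG κ hκ]
    ring
  obtain ⟨q, hq, hqH⟩ := eq_polynomial_of_isBigO N (hH.sub differentiable_G) hO
  -- Writes `G` itself as `κ^N + V(κ) a0`, so that adding the remainder `q` of degree below `N`
  -- exhibits `H` in the same form.
  have hG := monic_eq_prod hinj ((mulVec_eq_neg_iff (det_revVandermonde_ne_zero hinj) _ _).2 rfl)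
  set a0 : Fin N → ℂ := -Matrix.mulVec (revVandermonde k)⁻¹ fun j => k j ^ N
  set a : Fin N → ℂ := fun c => q.coeff (c.rev : ℕ) + a0 c
  have hHa : ∀ κ, H κ = κ ^ N + dotProduct (vecV N κ) a := by
    intro κ
    have h1 : H κ - G k κ = q.eval κ := hqH κ
    rw [eq_sum_rev_of_coeff_eq_zero hq] at h1
    have h2 : G k κ = κ ^ N + dotProduct (vecV N κ) a0 := (hG κ).symm
    rw [dotProduct_vecV] at h2 ⊢
    simp only [a, add_mul, Finset.sum_add_distrib]
    linear_combination h1 + h2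
  have hglue : ∀ κ, κ ∉ Set.range k →
      gluePM Φp Φm κ = Complex.exp (κ * x) * H κ / G k κ := by
    intro κ hκ
    have hG0 : G k κ ≠ 0 := fun h => hκ (G_eq_zero_iff.1 h)
    rw [hHG κ hκ, eq_div_iff hG0, Complex.exp_neg]
    field_simp [Complex.exp_ne_zero]
  have hbs : ∀ j, k j ^ N + dotProduct (vecV N (k j)) a = -gam k E j * chi k j x t *
      ((z * k j) ^ N + dotProduct (vecV N (z * k j)) a) := by
    intro j
    have hF := F_ne_zero hk (of_mem_poleSector (hk j)).2.2.1.le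
    rw [← hHa, ← hHa, ← bound_state_iff hk x t j]
    have hzm := subset_closure (z_mul_mem_minusRegion (hk j))
    have hz' : Φm (z * k j) = Complex.exp (z * k j * x) * H (z * k j) / G k (z * k j) := by
      rw [← gluePM_minus hs hzm, hglue _ (notMem_range_of_re hk (re_z_mul_pos (hk j)).le)]
    have h1 : ContinuousAt (fun κ => Complex.exp (κ * x) * H κ / F k κ) (k j) := by
      have : Differentiable ℂ fun κ : ℂ => Complex.exp (κ * x) * H κ := by fun_prop
      exact ((this _).div (differentiable_F _) hF).continuousAt
    have h2 := h1.tendsto.mono_left (nhdsWithin_le_nhds (s := {k j}ᶜ))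
    have h3 := hs.bound_state j
    rw [hz'] at h3
    -- Near `k_j` the quotient of the plus function by `Tl` equals `e^{κx} H / F`, which is
    -- continuous at `k_j`; its value there must be the prescribed limit.
    refine tendsto_nhds_unique h2 (h3.congr' ?_)
    filter_upwards [eventually_notMem_range (k := k) (k j), mem_nhdsWithin_of_mem_nhds
        (isOpen_plusRegion.mem_nhds (mem_plusRegion_of_mem_poleSector (hk j)))] with κ hκ hκ'
    have hG0 : G k κ ≠ 0 := fun h => hκ (G_eq_zero_iff.1 h)
    rw [← gluePM_plus (Φp := Φp) (Φm := Φm) (subset_closure hκ'), hglue κ hκ, Tl,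
      div_div_div_cancel_right₀ hG0]
  have ha : a = vecA k E x t := (mulVec_eq_neg_iff hp _ _).1 ((system_iff_mulVec x t a).1 hbs)
  rw [hglue κ hκ, hHa, ha]
  rfl

theorem isRHSolution_unique (hk : ∀ j, k j ∈ poleSector) (hinj : Function.Injective k)
    (hp : (x, t) ∈ regularSet k E) (hs : IsRHSolution k E x t Φp Φm) :
    (∀ κ ∈ closure plusRegion, κ ∉ Set.range k → Φp κ = Phi k E κ x t) ∧
      (∀ κ ∈ closure minusRegion, Φm κ = Phi k E κ x t) ∧
      (∀ κ ∈ closure Omega1, κ ∉ Set.range k → Φp κ = Tl k κ * solf k E κ x t) ∧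
      (∀ κ ∈ closure Omega2, Φp κ = solm k E κ x t) ∧
      (∀ κ ∈ closure Omega3, Φm κ = solg k E κ x t) ∧
      (∀ κ ∈ closure Omega4, Φm κ = soln k E κ x t) := by
  have hplus : ∀ κ ∈ closure plusRegion, κ ∉ Set.range k → Φp κ = Phi k E κ x t :=
    fun κ hκ hr => by rw [← gluePM_plus (Φp := Φp) (Φm := Φm) hκ, numerator_of_isRHSolution hk hinj hp hs hr]
  have hminus : ∀ κ ∈ closure minusRegion, Φm κ = Phi k E κ x t := fun κ hκ => by
    rw [← gluePM_minus hs hκ, numerator_of_isRHSolution hk hinj hp hs fun hr =>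
      G_ne_zero_of_mem_closure_minusRegion hk hκ (G_eq_zero_iff.2 hr)]
  refine ⟨hplus, hminus, fun κ hκ hr => ?_, fun κ hκ => ?_, fun κ hκ => ?_, fun κ hκ => ?_⟩
  · rw [hplus κ (mem_closure_plusRegion.2 (of_mem_closure_Omega1 hκ).2) hr, Phi, Tl, solf, mul_comm,
      div_mul_div_cancel₀ (F_ne_zero hk (re_nonpos_of_mem_closure_Omega1 hκ))]
  · exact hplus κ (mem_closure_plusRegion.2 (of_mem_closure_Omega2 hκ).2) fun hr =>
      G_ne_zero_of_mem_closure_Omega hk (Or.inl (Or.inl hκ)) (G_eq_zero_iff.2 hr)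
  · exact hminus κ (mem_closure_minusRegion.2 (of_mem_closure_Omega3 hκ).1)
  · exact hminus κ (mem_closure_minusRegion.2 (of_mem_closure_Omega4 hκ).1)

end RiemannHilbert

/-! ### The explicit 1-soliton -/

section OneSoliton

theorem z_sub_one_mul_I_mul_z : (z - 1) * (Complex.I * z) = (Real.sqrt 3 : ℝ) := by
  have h := sqrt_three_sq
  apply Complex.ext <;> simp [z_re, z_im] <;> linarith

variable {N : ℕ} {k E : Fin N → ℂ} {j : Fin N} {η : ℝ}

theorem chi_eq_of_eq (hj : k j = Complex.I * z * η) (x t : ℝ) :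
    chi k j x t = Complex.exp ((Real.sqrt 3 * η * (x - 9 * η ^ 4 * t) : ℝ)) := by
  have h1 : (z - 1) * k j = ((Real.sqrt 3 * η : ℝ) : ℂ) := by
    rw [hj, Complex.ofReal_mul, ← z_sub_one_mul_I_mul_z]
    ring
  -- Source of the speed `9 η⁴`: the `t`-exponent is `-(√3 η)⁵ = -√3 η · 9 η⁴`.
  have h3 : Real.sqrt 3 ^ 5 = 9 * Real.sqrt 3 := by
    linear_combination (Real.sqrt 3 ^ 3 + 3 * Real.sqrt 3) * sqrt_three_sq
  have h2 : 9 * (z ^ 2 - 1) * k j ^ 5 = ((-(Real.sqrt 3 * η) ^ 5 : ℝ) : ℂ) := by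
    push_cast
    rw [← Complex.ofReal_mul, ← h1]
    linear_combination k j ^ 5 * (z ^ 3 - 6 * z ^ 2 + 15 * z - 10) * z_sq
  rw [chi, h1, h2, ← Complex.ofReal_mul, ← Complex.ofReal_mul, ← Complex.ofReal_add]
  congr 2
  rw [mul_pow, h3]
  ring

end OneSoliton

section OneSolitonFormulas

variable {k E : Fin 1 → ℂ} {j : Fin 1} {η : ℝ}

theorem mem_regularSet_one (x t : ℝ) :
    (x, t) ∈ regularSet k E ↔ 1 + gam k E j * chi k j x t ≠ 0 := by
  obtain rfl := Subsingleton.elim 0 j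
  rw [regularSet, Set.mem_ofPred_eq, Matrix.det_fin_one]
  simp [matM, mEntry]

theorem coeffA_one {x t : ℝ} (hp : (x, t) ∈ regularSet k E) :
    coeffA k E 0 x t =
      -(k j * (1 + z * (gam k E j * chi k j x t))) / (1 + gam k E j * chi k j x t) := by
  have h := congrFun (vecA_spec hp) j
  rw [matM_mulVec, Pi.neg_apply, vecB_apply] at h
  rw [eq_div_iff ((mem_regularSet_one x t).1 hp)]
  obtain rfl := Subsingleton.elim 0 j
  simp only [dotProduct_vecV, Finset.univ_unique, Fin.default_eq_zero, Finset.sum_singleton,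
    Fin.val_rev, Fin.val_zero, zero_add, Nat.sub_self, pow_zero, mul_one, pow_one] at h
  rw [coeffA, dif_pos one_pos]
  change vecA k E x t 0 * _ = _
  linear_combination h

theorem hasDerivAt_gam_mul_chi (hj : k j = Complex.I * z * η) (x t : ℝ) :
    HasDerivAt (fun y => gam k E j * chi k j y t)
      ((Real.sqrt 3 : ℝ) * η * (gam k E j * chi k j x t)) x := by
  refine ((hasDerivAt_cexp_linear ((z - 1) * k j) (9 * (z ^ 2 - 1) * k j ^ 5 * t) x).const_mul
    (gam k E j)).congr_deriv ?_
  rw [chi, hj, ← z_sub_one_mul_I_mul_z]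
  ring

theorem eventually_mem_regularSet {N : ℕ} {k E : Fin N → ℂ} {x t : ℝ}
    (hp : (x, t) ∈ regularSet k E) : ∀ᶠ y in 𝓝 x, (y, t) ∈ regularSet k E :=
  (Continuous.prodMk_left t).continuousAt.preimage_mem_nhds (isOpen_regularSet.mem_nhds hp)

theorem deriv_coeffA_one (hj : k j = Complex.I * z * η) {x t : ℝ} (hp : (x, t) ∈ regularSet k E) :
    deriv (fun y => coeffA k E 0 y t) x = -3 * η ^ 2 * (gam k E j * chi k j x t) /
      (1 + gam k E j * chi k j x t) ^ 2 := by
  have hw := hasDerivAt_gam_mul_chi (E := E) hj x t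
  have h0 := (mem_regularSet_one (j := j) x t).1 hp
  have h1 := (((hw.const_mul z).const_add 1).const_mul (k j)).fun_neg.fun_div (hw.const_add 1) h0
  have h2 : (fun y => coeffA k E 0 y t) =ᶠ[𝓝 x] _ :=
    (eventually_mem_regularSet hp).mono fun y hy => coeffA_one (j := j) hy
  rw [h2.deriv_eq, h1.deriv]
  have hs : ((Real.sqrt 3 : ℝ) : ℂ) ^ 2 = 3 := by exact_mod_cast sqrt_three_sq
  congr 1
  rw [hj]
  linear_combination (-(Real.sqrt 3 : ℝ) * η ^ 2 * (gam k E j * chi k j x t)) *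
    z_sub_one_mul_I_mul_z - η ^ 2 * (gam k E j * chi k j x t) * hs

theorem iteratedDeriv_two_coeffA_one (hj : k j = Complex.I * z * η) {x t : ℝ}
    (hp : (x, t) ∈ regularSet k E) :
    iteratedDeriv 2 (fun y => coeffA k E 0 y t) x =
      -3 * (Real.sqrt 3 : ℝ) * η ^ 3 * (gam k E j * chi k j x t) * (1 - gam k E j * chi k j x t) /
      (1 + gam k E j * chi k j x t) ^ 3 := by
  have hw := hasDerivAt_gam_mul_chi (E := E) hj x t
  have h0 := (mem_regularSet_one (j := j) x t).1 hp
  have h1 := (hw.const_mul (-3 * (η : ℂ) ^ 2)).fun_div ((hw.const_add 1).fun_pow 2)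
    (pow_ne_zero 2 h0)
  have h2 : deriv (fun y => coeffA k E 0 y t) =ᶠ[𝓝 x] _ :=
    (eventually_mem_regularSet hp).mono fun y hy => deriv_coeffA_one (j := j) hj hy
  rw [iteratedDeriv_succ, iteratedDeriv_one, h2.deriv_eq, h1.deriv]
  field_simp
  push_cast
  ring

theorem potQ_one (hj : k j = Complex.I * z * η) {x t : ℝ} (hp : (x, t) ∈ regularSet k E) :
    potQ k E x t = 9 * η ^ 2 * (gam k E j * chi k j x t) / (1 + gam k E j * chi k j x t) ^ 2 := by
  rw [potQ, deriv_coeffA_one hj hp]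
  ring

theorem potP_one (hj : k j = Complex.I * z * η) {x t : ℝ} (hp : (x, t) ∈ regularSet k E) :
    potP k E x t = 9 * Complex.I * z * η ^ 3 * (gam k E j * chi k j x t)
      * (z + gam k E j * chi k j x t) / (1 + gam k E j * chi k j x t) ^ 3 := by
  have h0 := (mem_regularSet_one (j := j) x t).1 hp
  -- For `N = 1` this coefficient is the conventional `A_{-1} = 0`.
  have h1 : deriv (fun y => coeffA k E 1 y t) x = 0 := by
    have : (fun y => coeffA k E 1 y t) = fun _ => 0 := funext fun y => by simp [coeffA]
    rw [this, deriv_const]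
  rw [potP, deriv_coeffA_one hj hp, iteratedDeriv_two_coeffA_one hj hp, h1, coeffA_one (j := j) hp,
    ← z_sub_one_mul_I_mul_z, hj]
  generalize gam k E j * chi k j x t = w at h0
  field_simp
  ring

theorem one_soliton (hj : k j = Complex.I * z * η) :
    (∀ x t : ℝ,
      let w : ℂ := gam k E j * Complex.exp ((Real.sqrt 3 * η * (x - 9 * η ^ 4 * t) : ℝ))
      ((x, t) ∈ regularSet k E ↔ 1 + w ≠ 0) ∧
      ((x, t) ∈ regularSet k E →
        potQ k E x t = 9 * η ^ 2 * w / (1 + w) ^ 2 ∧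
        potP k E x t = 9 * Complex.I * z * η ^ 3 * w * (z + w) / (1 + w) ^ 3)) := by
  intro x t
  rw [← chi_eq_of_eq hj x t]
  exact ⟨mem_regularSet_one x t, fun hp => ⟨potQ_one hj hp, potP_one hj hp⟩⟩

theorem one_soliton_of_pos (hη : 0 < η) (hj : k j = Complex.I * z * η) {c : ℝ} (hc : 0 < c)
    (hγ : gam k E j = c) (x t : ℝ) :
    (x, t) ∈ regularSet k E ∧ (potQ k E x t).im = 0 ∧ (potP k E x t).im ≠ 0 := by
  obtain ⟨r, hr, hw⟩ : ∃ r : ℝ, 0 < r ∧ gam k E j * chi k j x t = r :=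
    ⟨c * Real.exp (Real.sqrt 3 * η * (x - 9 * η ^ 4 * t)), by positivity, by
      rw [hγ, chi_eq_of_eq hj]
      push_cast
      rfl⟩
  have hp : (x, t) ∈ regularSet k E := by
    rw [mem_regularSet_one (j := j), hw]
    exact_mod_cast (by positivity : (1 + r) ≠ 0)
  have hq := potQ_one hj hp
  have hpp := potP_one hj hp
  rw [hw] at hq hpp
  refine ⟨hp, ?_, ?_⟩
  · rw [hq, show (9 * η ^ 2 * r / (1 + r) ^ 2 : ℂ) = ((9 * η ^ 2 * r / (1 + r) ^ 2 : ℝ) : ℂ) by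
      push_cast; rfl, Complex.ofReal_im]
  · have e : (9 * Complex.I * z * η ^ 3 * r * (z + r) / (1 + r) ^ 3 : ℂ) =
        ((9 * η ^ 3 * r / (1 + r) ^ 3 : ℝ) : ℂ) * (Complex.I * (z ^ 2 + z * r)) := by
      push_cast
      ring
    rw [hpp, e, Complex.im_ofReal_mul, z_sq]
    refine mul_ne_zero (by positivity) ?_
    -- The remaining factor is the real part of `z² + z r`, namely `-(1 + r)/2`, which is negative
    -- for `r > 0`.
    simp [z_re, z_im]
    linarith

end OneSolitonFormulas

end NSoliton

end

theorem mainTheorem1 (N : ℕ) (hN : 0 < N) (k E : Fin N → ℂ)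
    (hk : ∀ j, k j ∈ NSoliton.poleSector) (hinj : Function.Injective k) (hE : ∀ j, E j ≠ 0) :
    -- the linear system is nonsingular on an open set, dense on every time slice
    (IsOpen (NSoliton.regularSet k E) ∧ ∀ t : ℝ, Dense {x : ℝ | (x, t) ∈ NSoliton.regularSet k E}) ∧
    -- the exponentials are real valued exactly for `k_j = i z η_j` with `η_j > 0`
    (∀ j, (∀ x t : ℝ, (NSoliton.chi k j x t).im = 0) ↔
      ∃ η : ℝ, 0 < η ∧ k j = Complex.I * NSoliton.z * η) ∧
    -- the linear system determines the coefficients; Cramer's rule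
    (∀ x t : ℝ, (x, t) ∈ NSoliton.regularSet k E →
      (∀ a : Fin N → ℂ,
        ((∀ j, k j ^ N + dotProduct (NSoliton.vecV N (k j)) a =
            -NSoliton.gam k E j * NSoliton.chi k j x t *
              ((NSoliton.z * k j) ^ N + dotProduct (NSoliton.vecV N (NSoliton.z * k j)) a)) ↔
          Matrix.mulVec (NSoliton.matM k E x t) a = -NSoliton.vecB k E x t) ∧
        (Matrix.mulVec (NSoliton.matM k E x t) a = -NSoliton.vecB k E x t ↔
          a = NSoliton.vecA k E x t)) ∧
      ∀ c : Fin N, NSoliton.vecA k E x t c =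
        -(((NSoliton.matM k E x t).updateCol c (NSoliton.vecB k E x t)).det /
          (NSoliton.matM k E x t).det)) ∧
    -- the coefficients are smooth functions of `(x, t)`
    (∀ c : Fin N, ContDiffOn ℝ ∞ (fun p : ℝ × ℝ => NSoliton.vecA k E p.1 p.2 c)
      (NSoliton.regularSet k E)) ∧
    -- the Riemann--Hilbert problem has exactly one solution, the explicit one
    (∀ x t : ℝ, (x, t) ∈ NSoliton.regularSet k E →
      NSoliton.IsRHSolution k E x t
        (fun κ => NSoliton.Phi k E κ x t) (fun κ => NSoliton.Phi k E κ x t) ∧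
      ∀ Φp Φm : ℂ → ℂ, NSoliton.IsRHSolution k E x t Φp Φm →
        (∀ κ ∈ closure NSoliton.plusRegion, κ ∉ Set.range k → Φp κ = NSoliton.Phi k E κ x t) ∧
        (∀ κ ∈ closure NSoliton.minusRegion, Φm κ = NSoliton.Phi k E κ x t) ∧
        (∀ κ ∈ closure NSoliton.Omega1, κ ∉ Set.range k →
          Φp κ = NSoliton.Tl k κ * NSoliton.solf k E κ x t) ∧
        (∀ κ ∈ closure NSoliton.Omega2, Φp κ = NSoliton.solm k E κ x t) ∧
        (∀ κ ∈ closure NSoliton.Omega3, Φm κ = NSoliton.solg k E κ x t) ∧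
        (∀ κ ∈ closure NSoliton.Omega4, Φm κ = NSoliton.soln k E κ x t)) ∧
    -- the denominators do not vanish on the respective domains
    ((∀ κ ∈ closure NSoliton.Omega1, NSoliton.F k κ ≠ 0) ∧
      ∀ κ ∈ closure NSoliton.Omega2 ∪ closure NSoliton.Omega3 ∪ closure NSoliton.Omega4,
        NSoliton.G k κ ≠ 0) ∧
    -- the bound-state relations
    (∀ x t : ℝ, (x, t) ∈ NSoliton.regularSet k E → ∀ j,
      NSoliton.solf k E (k j) x t =
        NSoliton.depConst k E j t * NSoliton.solg k E (NSoliton.z * k j) x t) ∧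
    -- large-`κ` expansion of `f` and recovery of the potentials from it
    (∀ x t : ℝ, (x, t) ∈ NSoliton.regularSet k E →
      ((fun κ : ℂ => Complex.exp (-(κ * x)) * NSoliton.solf k E κ x t
          - (1 + NSoliton.u1 k E x t / κ + NSoliton.u2 k E x t / κ ^ 2))
        =O[Bornology.cobounded ℂ ⊓ Filter.principal (closure NSoliton.Omega1)]
          fun κ => (κ ^ 3)⁻¹) ∧
      NSoliton.potQ k E x t = -3 * deriv (fun y => NSoliton.u1 k E y t) x ∧
      NSoliton.potP k E x t =
        3 * (NSoliton.u1 k E x t * deriv (fun y => NSoliton.u1 k E y t) x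
          - iteratedDeriv 2 (fun y => NSoliton.u1 k E y t) x
          - deriv (fun y => NSoliton.u2 k E y t) x)) ∧
    -- `f`, `m`, `g`, `n` solve the third-order linear equation
    (∀ x t : ℝ, (x, t) ∈ NSoliton.regularSet k E →
      (∀ κ ∈ closure NSoliton.Omega1,
        NSoliton.SolvesLinear (fun y => NSoliton.potQ k E y t) (fun y => NSoliton.potP k E y t) κ
          (fun y => NSoliton.solf k E κ y t) x) ∧
      (∀ κ ∈ closure NSoliton.Omega2,
        NSoliton.SolvesLinear (fun y => NSoliton.potQ k E y t) (fun y => NSoliton.potP k E y t) κ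
          (fun y => NSoliton.solm k E κ y t) x) ∧
      (∀ κ ∈ closure NSoliton.Omega3,
        NSoliton.SolvesLinear (fun y => NSoliton.potQ k E y t) (fun y => NSoliton.potP k E y t) κ
          (fun y => NSoliton.solg k E κ y t) x) ∧
      (∀ κ ∈ closure NSoliton.Omega4,
        NSoliton.SolvesLinear (fun y => NSoliton.potQ k E y t) (fun y => NSoliton.potP k E y t) κ
          (fun y => NSoliton.soln k E κ y t) x)) ∧
    -- behaviour of `f` and `g` as `x → -∞`
    (∀ t : ℝ,
      (∀ κ ∈ closure NSoliton.Omega3,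
        NSoliton.HasJostAsymptotics Filter.atBot κ (fun x => NSoliton.solg k E κ x t)) ∧
      (∀ κ ∈ closure NSoliton.Omega1,
        Filter.Tendsto (fun x : ℝ => Complex.exp (-(κ * x)) * NSoliton.solf k E κ x t)
          Filter.atBot (𝓝 (NSoliton.Tl k κ)⁻¹))) ∧
    -- behaviour of `f` and `g` as `x → +∞` for poles `k_j = i z η_j`
    ((∀ j, ∃ η : ℝ, 0 < η ∧ k j = Complex.I * NSoliton.z * η) → ∀ t : ℝ,
      (∀ κ ∈ closure NSoliton.Omega1,
        NSoliton.HasJostAsymptotics Filter.atTop κ (fun x => NSoliton.solf k E κ x t)) ∧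
      (∀ κ ∈ closure NSoliton.Omega3,
        Filter.Tendsto (fun x : ℝ => Complex.exp (-(κ * x)) * NSoliton.solg k E κ x t)
          Filter.atTop (𝓝 (NSoliton.Tr k κ)⁻¹))) ∧
    -- the potentials solve the coupled fifth-order system
    NSoliton.IsClassicalSolutionOn (NSoliton.potQ k E) (NSoliton.potP k E)
      (NSoliton.regularSet k E) ∧
    -- the explicit 1-soliton
    (N = 1 → ∀ (j : Fin N) (η : ℝ), 0 < η → k j = Complex.I * NSoliton.z * η →
      (∀ x t : ℝ,
        let w : ℂ := NSoliton.gam k E j *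
          Complex.exp ((Real.sqrt 3 * η * (x - 9 * η ^ 4 * t) : ℝ))
        ((x, t) ∈ NSoliton.regularSet k E ↔ 1 + w ≠ 0) ∧
        ((x, t) ∈ NSoliton.regularSet k E →
          NSoliton.potQ k E x t = 9 * η ^ 2 * w / (1 + w) ^ 2 ∧
          NSoliton.potP k E x t =
            9 * Complex.I * NSoliton.z * η ^ 3 * w * (NSoliton.z + w) / (1 + w) ^ 3)) ∧
      (∀ c : ℝ, 0 < c → NSoliton.gam k E j = c → ∀ x t : ℝ,
        (x, t) ∈ NSoliton.regularSet k E ∧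
        (NSoliton.potQ k E x t).im = 0 ∧ (NSoliton.potP k E x t).im ≠ 0)) := by
  refine ⟨⟨NSoliton.isOpen_regularSet, NSoliton.dense_regular_slice hk hinj⟩,
    NSoliton.chi_real_iff hk,
    fun x t hp => ⟨fun a => ⟨NSoliton.system_iff_mulVec x t a,
      NSoliton.mulVec_eq_neg_iff hp _ a⟩, NSoliton.vecA_cramer hp⟩,
    NSoliton.contDiffOn_vecA,
    fun x t hp => ⟨NSoliton.Phi_isRHSolution hk hinj hp, fun Φp Φm hs =>
      NSoliton.isRHSolution_unique hk hinj hp hs⟩,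
    ⟨fun κ hκ => NSoliton.F_ne_zero hk (NSoliton.re_nonpos_of_mem_closure_Omega1 hκ),
      fun κ hκ => NSoliton.G_ne_zero_of_mem_closure_Omega hk hκ⟩,
    fun x t hp j => NSoliton.solf_bound_state hk hp j,
    fun x t hp => ⟨NSoliton.solf_expansion x t _, NSoliton.potQ_eq_u1 x t,
      NSoliton.potP_eq_u hp⟩,
    fun x t hp => ⟨fun κ _ => NSoliton.solvesLinear_numer_div κ _ hp,
      fun κ _ => NSoliton.solvesLinear_numer_div κ _ hp,
      fun κ _ => NSoliton.solvesLinear_numer_div κ _ hp,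
      fun κ _ => NSoliton.solvesLinear_numer_div κ _ hp⟩,
    NSoliton.jost_atBot hk hinj, NSoliton.jost_atTop hk hinj hE,
    NSoliton.isClassicalSolutionOn, ?_⟩
  rintro rfl j η hη hj
  exact ⟨NSoliton.one_soliton hj, fun c hc hγ x t => NSoliton.one_soliton_of_pos hη hj hc hγ x t⟩
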